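/- Let $\mathcal D$ be a strongly self-absorbing $C^*$-algebra, i.e. a unital separable $C^*$-algebra $\mathcal D\not\cong\mathbb C$ for which there is an isomorphism $\mathcal D\to\mathcal D\hat\otimes\mathcal D$ that is approximately unitarily equivalent to the first factor embedding $d\mapsto d\otimes 1$; here $\hat\otimes$ is the maximal $C^*$-tensor product. For $j\ge 0$ let $\mathcal D(j)$ be the set of unital full $*$-homomorphisms $\mathcal D^{\hat\otimes j}\to\mathcal D$ (with $\mathcal D^{\hat\otimes 0}=\mathbb C$), with the point-norm topology; a $*$-homomorphism is full if the image of every nonzero element generates the target as a closed two-sided ideal. Then the collection $\{\mathcal D(j)\}_{j\ge 0}$ is a symmetric operad, in the sense of May, in the category of compactly generated weakly Hausdorff spaces, with the following structure: - the composition $\gamma:\mathcal D(k)\times\mathcal D(j_1)\times\cdots\times\mathcal D(j_k)\to\mathcal D(j_1+\cdots+j_k)$ is $\gamma(\alpha;\beta_1,\dots,\beta_k)=\alpha\circ(\beta_1\hat\otimes\cdots\hat\otimes\beta_k)$; - the unit is $\mathrm{id}_{\mathcal D}\in\mathcal D(1)$; - the symmetric group $\Sigma_j$ acts on $\mathcal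 D(j)$ from the right by permuting the tensor factors: $(\alpha\cdot\sigma)(x_1\otimes\cdots\otimes x_j)=\alpha(x_{\sigma^{-1}(1)}\otimes\cdots\otimes x_{\sigma^{-1}(j)})$. That is, each $\mathcal D(j)$ is compactly generated and weakly Hausdorff, these maps are well defined and continuous, and they satisfy the associativity, unitality and equivariance axioms of an operad. -/

import Mathlib

universe u v w

open scoped TensorProduct

noncomputable section

/-! ## C*-seminorms and the associated C*-algebras -/

/-- A C*-seminorm on a complex unital *-algebra `R`: a submultiplicative seminorm `p` with
`p (x* x) = p(x)²`. -/
structure CStarSeminorm (R : Type w) [Ring R] [StarRing R] [Algebra ℂ R] extends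
    Seminorm ℂ R where
  mul_le' : ∀ x y : R, toFun (x * y) ≤ toFun x * toFun y
  star_mul_self' : ∀ x : R, toFun (star x * x) = toFun x * toFun x

namespace CStarSeminorm

section Basic

variable {R : Type w} [Ring R] [StarRing R] [Algebra ℂ R]

instance : FunLike (CStarSeminorm R) R ℝ where
  coe p := p.toFun
  coe_injective p q h := by
    cases p; cases q; congr; exact DFunLike.coe_injective h

instance : SeminormClass (CStarSeminorm R) ℂ R where
  map_zero p := p.toSeminorm.map_zero'
  map_add_le_add p := p.toSeminorm.add_le'
  map_neg_eq_map p := p.toSeminorm.neg'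
  map_smul_eq_mul p := p.toSeminorm.smul'

theorem mul_le (p : CStarSeminorm R) (x y : R) : p (x * y) ≤ p x * p y := p.mul_le' x y

theorem star_mul_self (p : CStarSeminorm R) (x : R) : p (star x * x) = p x * p x :=
  p.star_mul_self' x

theorem le_map_star (p : CStarSeminorm R) (x : R) : p x ≤ p (star x) := by
  rcases (apply_nonneg p x).eq_or_lt with h | h
  · rw [← h]; exact apply_nonneg p _
  · exact le_of_mul_le_mul_right ((p.star_mul_self x).symm.le.trans (p.mul_le _ _)) h

theorem map_star (p : CStarSeminorm R) (x : R) : p (star x) = p x :=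
  le_antisymm (by simpa using p.le_map_star (star x)) (p.le_map_star x)

/-- A copy of `R`, to be equipped with the seminorm `p`. -/
@[nolint unusedArguments]
def Carrier (_ : CStarSeminorm R) : Type w := R

variable (p : CStarSeminorm R)

instance : Ring p.Carrier := inferInstanceAs (Ring R)
instance : StarRing p.Carrier := inferInstanceAs (StarRing R)
instance : Algebra ℂ p.Carrier := inferInstanceAs (Algebra ℂ R)
instance [StarModule ℂ R] : StarModule ℂ p.Carrier := inferInstanceAs (StarModule ℂ R)

/-- The identity map from `R` to its copy seminormed by `p`. -/
def toCarrier : R → p.Carrier := fun x => x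

instance : SeminormedRing p.Carrier where
  __ := (inferInstance : Ring p.Carrier)
  __ := AddGroupSeminorm.toSeminormedAddCommGroup
    (E := p.Carrier) (p.toSeminorm.toAddGroupSeminorm : AddGroupSeminorm R)
  norm_mul_le x y := p.mul_le' x y

theorem norm_toCarrier (x : R) : ‖p.toCarrier x‖ = p x := rfl

instance : NormedAlgebra ℂ p.Carrier where
  norm_smul_le c x := (map_smul_eq_mul p c (x : R)).le

instance : NormedStarGroup p.Carrier where
  norm_star_le x := (p.map_star x).le

/-- The C*-algebra associated with a C*-seminorm: the Hausdorff completion of `R` for `p`, that is,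
the completion of `R` modulo the null space of `p`. -/
def Compl : Type w := UniformSpace.Completion p.Carrier

instance : NormedRing p.Compl := inferInstanceAs (NormedRing (UniformSpace.Completion p.Carrier))
instance : CompleteSpace p.Compl :=
  inferInstanceAs (CompleteSpace (UniformSpace.Completion p.Carrier))
instance : Algebra ℂ p.Compl :=
  inferInstanceAs (Algebra ℂ (UniformSpace.Completion p.Carrier))

/-- The canonical map from `R` to its completion for `p`. -/
def toCompl (x : R) : p.Compl := ((p.toCarrier x : p.Carrier) : UniformSpace.Completion p.Carrier)

theorem denseRange_toCompl : DenseRange p.toCompl :=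
  UniformSpace.Completion.denseRange_coe (α := p.Carrier)

theorem norm_toCompl (x : R) : ‖p.toCompl x‖ = p x :=
  UniformSpace.Completion.norm_coe (p.toCarrier x)

theorem toCompl_add (x y : R) : p.toCompl (x + y) = p.toCompl x + p.toCompl y :=
  UniformSpace.Completion.coe_add (p.toCarrier x) (p.toCarrier y)

theorem toCompl_mul (x y : R) : p.toCompl (x * y) = p.toCompl x * p.toCompl y :=
  UniformSpace.Completion.coe_mul (p.toCarrier x) (p.toCarrier y)

theorem toCompl_one : p.toCompl 1 = 1 := rfl

theorem toCompl_zero : p.toCompl 0 = 0 := rfl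

theorem toCompl_smul (c : ℂ) (x : R) : p.toCompl (c • x) = c • p.toCompl x :=
  UniformSpace.Completion.coe_smul c (p.toCarrier x)

instance : NormedAlgebra ℂ p.Compl where
  norm_smul_le c x := norm_smul_le (β := UniformSpace.Completion p.Carrier) c x

instance : Star p.Compl where
  star := UniformSpace.Completion.map (star : p.Carrier → p.Carrier)

theorem continuous_star_compl : Continuous (star : p.Compl → p.Compl) :=
  UniformSpace.Completion.continuous_map

theorem toCompl_star (x : R) : p.toCompl (star x) = star (p.toCompl x) :=
  (UniformSpace.Completion.map_coe
    (f := (star : p.Carrier → p.Carrier)) star_isometry.uniformContinuous (p.toCarrier x)).symm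

instance : StarRing p.Compl where
  star_involutive x := by
    induction x using p.denseRange_toCompl.induction_on with
    | hp => exact isClosed_eq (p.continuous_star_compl.comp p.continuous_star_compl) continuous_id
    | ih x => rw [← toCompl_star, ← toCompl_star, star_star]
  star_mul x y := by
    induction x, y using p.denseRange_toCompl.induction_on₂ with
    | hp =>
      exact isClosed_eq (p.continuous_star_compl.comp continuous_mul)
        ((p.continuous_star_compl.comp continuous_snd).mul
          (p.continuous_star_compl.comp continuous_fst))
    | h x y => rw [← toCompl_mul, ← toCompl_star, star_mul, toCompl_mul, toCompl_star, toCompl_star]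
  star_add x y := by
    induction x, y using p.denseRange_toCompl.induction_on₂ with
    | hp =>
      exact isClosed_eq (p.continuous_star_compl.comp continuous_add)
        ((p.continuous_star_compl.comp continuous_fst).add
          (p.continuous_star_compl.comp continuous_snd))
    | h x y => rw [← toCompl_add, ← toCompl_star, star_add, toCompl_add, toCompl_star, toCompl_star]

instance : CStarRing p.Compl where
  norm_mul_self_le x := by
    induction x using p.denseRange_toCompl.induction_on with
    | hp =>
      exact isClosed_le (continuous_norm.mul continuous_norm)
        (continuous_norm.comp (p.continuous_star_compl.mul continuous_id))
    | ih x => rw [← toCompl_star, ← toCompl_mul, norm_toCompl, norm_toCompl, star_mul_self]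

instance [StarModule ℂ R] : StarModule ℂ p.Compl where
  star_smul c x := by
    induction x using p.denseRange_toCompl.induction_on with
    | hp =>
      exact isClosed_eq (p.continuous_star_compl.comp (continuous_const_smul c))
        (p.continuous_star_compl.const_smul (star c))
    | ih x => rw [← toCompl_smul, ← toCompl_star, star_smul, toCompl_smul, toCompl_star]

instance [StarModule ℂ R] : CStarAlgebra p.Compl where

end Basic

/-- A C*-seminorm on a C*-algebra is dominated by the norm. -/
theorem le_norm {A : Type w} [CStarAlgebra A] (p : CStarSeminorm A) (a : A) : p a ≤ ‖a‖ := by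
  let f : A →⋆ₐ[ℂ] p.Compl :=
    { toFun := p.toCompl
      map_one' := p.toCompl_one
      map_mul' := p.toCompl_mul
      map_zero' := p.toCompl_zero
      map_add' := p.toCompl_add
      commutes' := fun c => by
        rw [Algebra.algebraMap_eq_smul_one, toCompl_smul, toCompl_one,
          Algebra.algebraMap_eq_smul_one]
      map_star' := p.toCompl_star }
  rw [← p.norm_toCompl]
  exact NonUnitalStarAlgHom.norm_apply_le f a

section Sup

variable {R : Type w} [Ring R] [StarRing R] [Algebra ℂ R]

/-- The zero C*-seminorm. -/
instance : Inhabited (CStarSeminorm R) :=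
  ⟨{ (0 : Seminorm ℂ R) with
      mul_le' := fun _ _ => (mul_zero (0 : ℝ)).ge
      star_mul_self' := fun _ => (mul_zero (0 : ℝ)).symm }⟩

/-- The supremum of all C*-seminorms on `R`, provided that they are pointwise bounded. -/
def sup (h : ∀ x : R, BddAbove (Set.range fun p : CStarSeminorm R => p x)) :
    CStarSeminorm R where
  toFun x := ⨆ p : CStarSeminorm R, p x
  map_zero' := by simp
  add_le' x y := ciSup_le fun p =>
    (map_add_le_add p x y).trans (add_le_add (le_ciSup (h x) p) (le_ciSup (h y) p))
  neg' x := by simp [map_neg_eq_map]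
  smul' c x := by simp [map_smul_eq_mul, Real.mul_iSup_of_nonneg]
  mul_le' x y := ciSup_le fun p => (p.mul_le x y).trans <|
    mul_le_mul (le_ciSup (h x) p) (le_ciSup (h y) p) (apply_nonneg p y)
      ((apply_nonneg p x).trans (le_ciSup (h x) p))
  star_mul_self' x := by
    have h0 : 0 ≤ ⨆ p : CStarSeminorm R, p x := Real.iSup_nonneg fun p => apply_nonneg p x
    refine le_antisymm (ciSup_le fun p => ?_) ?_
    · rw [p.star_mul_self]
      exact mul_self_le_mul_self (apply_nonneg p x) (le_ciSup (h x) p)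
    · rw [← sq, ← Real.le_sqrt h0 (Real.iSup_nonneg fun p => apply_nonneg p _)]
      refine ciSup_le fun p => Real.le_sqrt_of_sq_le ?_
      rw [sq, ← p.star_mul_self]
      exact le_ciSup (h (star x * x)) p

end Sup

end CStarSeminorm

/-! ## Maximal tensor products of C*-algebras -/

section Tensor

variable {ι : Type v} {A : ι → Type w} [∀ i, CStarAlgebra (A i)]

open PiTensorProduct in
/-- The involution on the algebraic tensor product, as an additive map:
`(r • ⨂ aᵢ)* = r̄ • ⨂ aᵢ*`. -/
def PiTensorProduct.starAddHom : (⨂[ℂ] i, A i) →+ (⨂[ℂ] i, A i) :=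
  liftAddHom (fun x => star x.1 • tprod ℂ (star x.2))
    (fun r f i hf => by
      rw [(tprod ℂ).map_coord_zero i (by simp [hf]), smul_zero])
    (fun f => by simp)
    (fun r f i a b => by
      simp only [← Function.update_star, star_add, MultilinearMap.map_update_add,
        smul_add])
    (fun r s f => by simp [add_smul])
    (fun r f i s => by
      simp only [← Function.update_star, star_smul, MultilinearMap.map_update_smul, smul_smul,
        star_mul, mul_comm]
      rw [← Pi.star_apply, Function.update_eq_self])

instance : Star (⨂[ℂ] i, A i) := ⟨PiTensorProduct.starAddHom⟩

namespace PiTensorProduct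

theorem star_smul_tprod (r : ℂ) (a : ∀ i, A i) :
    star (r • tprod ℂ a) = star r • tprod ℂ (star a) := by
  rw [← tprodCoeff_eq_smul_tprod]
  rfl

theorem star_tprod (a : ∀ i, A i) : star (tprod ℂ a) = tprod ℂ (star a) := by
  simpa using star_smul_tprod 1 a

theorem star_add' (x y : ⨂[ℂ] i, A i) : star (x + y) = star x + star y :=
  map_add PiTensorProduct.starAddHom x y

instance : StarRing (⨂[ℂ] i, A i) where
  star_involutive x := by
    induction x using PiTensorProduct.induction_on with
    | smul_tprod r a => rw [star_smul_tprod, star_smul_tprod, star_star, star_star]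
    | add x y hx hy => rw [star_add', star_add', hx, hy]
  star_add := star_add'
  star_mul x y := by
    induction x using PiTensorProduct.induction_on with
    | add x x' hx hx' => rw [add_mul, star_add', star_add', mul_add, hx, hx']
    | smul_tprod r a =>
      induction y using PiTensorProduct.induction_on with
      | add y y' hy hy' => rw [mul_add, star_add', star_add', add_mul, hy, hy']
      | smul_tprod s b =>
        simp only [smul_tprod_mul_smul_tprod, star_smul_tprod, star_mul]

instance : StarModule ℂ (⨂[ℂ] i, A i) where
  star_smul c x := by
    induction x using PiTensorProduct.induction_on with
    | smul_tprod r a => rw [smul_smul, star_smul_tprod, star_smul_tprod, smul_smul, star_mul, mul_comm]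
    | add x y hx hy => rw [smul_add, star_add', star_add', smul_add, hx, hy]

end PiTensorProduct

open PiTensorProduct

namespace CStarSeminorm

/-- The restriction of a C*-seminorm on the tensor product to one of the factors. -/
def single [DecidableEq ι] (p : CStarSeminorm (⨂[ℂ] i, A i)) (i : ι) : CStarSeminorm (A i) where
  toSeminorm := p.toSeminorm.comp (singleAlgHom (R := ℂ) (A := A) i).toLinearMap
  mul_le' x y := by
    have := p.mul_le (singleAlgHom (R := ℂ) i x) (singleAlgHom (R := ℂ) i y)
    rwa [← map_mul] at this
  star_mul_self' x := by
    have := p.star_mul_self (singleAlgHom (R := ℂ) i x)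
    have h : star (singleAlgHom (R := ℂ) (A := A) i x) = singleAlgHom (R := ℂ) i (star x) := by
      simp only [singleAlgHom_apply, star_tprod, MonoidHom.mulSingle_apply, Pi.mulSingle,
        ← Function.update_star, star_one]
    rwa [h, ← map_mul] at this

theorem map_tprod_le [Fintype ι] (p : CStarSeminorm (⨂[ℂ] i, A i)) (a : ∀ i, A i) :
    p (tprod ℂ a) ≤ ∏ i, ‖a i‖ := by
  classical
  have h1 : p 1 ≤ 1 := by
    have h := p.star_mul_self 1
    rw [star_one, mul_one] at h
    nlinarith [apply_nonneg p (1 : ⨂[ℂ] i, A i)]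
  have key : ∀ s : Finset ι, p (tprod ℂ (s.piecewise a 1)) ≤ ∏ i ∈ s, ‖a i‖ := by
    intro s
    induction s using Finset.induction_on with
    | empty => simpa [← PiTensorProduct.one_def] using h1
    | insert i s hi ih =>
      have h : tprod ℂ ((insert i s).piecewise a 1) =
          singleAlgHom (R := ℂ) (A := A) i (a i) * tprod ℂ (s.piecewise a 1) := by
        rw [singleAlgHom_apply, tprod_mul_tprod]
        congr 1
        ext j
        by_cases hj : j = i
        · subst hj
          simp [hi]
        · simp [Finset.piecewise, hj]
      rw [h, Finset.prod_insert hi]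
      exact (p.mul_le _ _).trans <|
        mul_le_mul ((p.single i).le_norm (a i)) ih (apply_nonneg p _) (norm_nonneg _)
  simpa using key Finset.univ

theorem bddAbove_tensor [Finite ι] (x : ⨂[ℂ] i, A i) :
    BddAbove (Set.range fun p : CStarSeminorm (⨂[ℂ] i, A i) => p x) := by
  have := Fintype.ofFinite ι
  induction x using PiTensorProduct.induction_on with
  | smul_tprod r a =>
    refine ⟨‖r‖ * ∏ i, ‖a i‖, ?_⟩
    rintro _ ⟨p, rfl⟩
    simpa only [map_smul_eq_mul] using
      mul_le_mul_of_nonneg_left (p.map_tprod_le a) (norm_nonneg r)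
  | add x y hx hy =>
    obtain ⟨C, hC⟩ := hx
    obtain ⟨C', hC'⟩ := hy
    refine ⟨C + C', ?_⟩
    rintro _ ⟨p, rfl⟩
    exact (map_add_le_add p x y).trans (add_le_add (hC ⟨p, rfl⟩) (hC' ⟨p, rfl⟩))

end CStarSeminorm

variable (A) in
/-- The maximal C*-norm on the algebraic tensor product: the largest C*-seminorm. -/
def maxCStarSeminorm [Finite ι] : CStarSeminorm (⨂[ℂ] i, A i) :=
  CStarSeminorm.sup CStarSeminorm.bddAbove_tensor

variable (A) in
/-- The maximal C*-tensor product of a finite family of unital C*-algebras: the completion of the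
algebraic tensor product for its maximal C*-norm. -/
abbrev MaxTensorProduct [Finite ι] : Type (max v w) := (maxCStarSeminorm A).Compl

/-- The elementary tensor `⨂ aᵢ` in the maximal C*-tensor product. -/
def maxTprod [Finite ι] (a : ∀ i, A i) : MaxTensorProduct A :=
  (maxCStarSeminorm A).toCompl (tprod ℂ a)

end Tensor

/-- The maximal tensor power `D ⊗ ⋯ ⊗ D` (`n` factors); it is `ℂ` for `n = 0`. -/
abbrev MaxTensorPower (D : Type u) [CStarAlgebra D] (n : ℕ) : Type u :=
  MaxTensorProduct fun _ : Fin n => D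

/-! ## Strongly self-absorbing C*-algebras -/

/-- Two maps `f g : A → B` into a unital C*-algebra are approximately unitarily equivalent if
`uₙ f(a) uₙ* → g(a)` for every `a`, for some sequence of unitaries `uₙ` of `B`. -/
def ApproxUnitarilyEquivalent {A : Type v} {B : Type w} [CStarAlgebra B] (f g : A → B) : Prop :=
  ∃ u : ℕ → unitary B, ∀ a : A,
    Filter.Tendsto (fun n => (u n : B) * f a * star (u n : B)) Filter.atTop (nhds (g a))

/-- A unital separable C*-algebra `D ≠ ℂ` is strongly self-absorbing if there is an isomorphism
`D ≅ D ⊗ D` that is approximately unitarily equivalent to the first factor embedding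
`d ↦ d ⊗ 1`. -/
structure IsStronglySelfAbsorbing (D : Type u) [CStarAlgebra D] : Prop where
  separable : TopologicalSpace.SeparableSpace D
  ne_complex : IsEmpty (D ≃⋆ₐ[ℂ] ℂ)
  exists_iso : ∃ φ : D ≃⋆ₐ[ℂ] MaxTensorPower D 2,
    ApproxUnitarilyEquivalent φ fun d : D => maxTprod ![d, 1]

/-! ## The spaces of the operad -/

/-- A *-homomorphism is full if no nonzero element is mapped into a proper closed two-sided ideal
of the target, that is, if the image of each nonzero element generates the target as a closed
two-sided ideal. -/
def IsFullHom {A : Type v} {B : Type w} [CStarAlgebra A] [CStarAlgebra B] (f : A →⋆ₐ[ℂ] B) : Prop :=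
  ∀ a : A, a ≠ 0 → ∀ I : TwoSidedIdeal B, IsClosed (I : Set B) → f a ∈ I → I = ⊤

/-- The set of unital full *-homomorphisms from the `n`-fold tensor power of `D` to `D`. -/
def UnitalFullHom (D : Type u) [CStarAlgebra D] (n : ℕ) : Type u :=
  {f : MaxTensorPower D n →⋆ₐ[ℂ] D // IsFullHom f}

namespace UnitalFullHom

variable {D : Type u} [CStarAlgebra D] {n : ℕ}

instance : CoeFun (UnitalFullHom D n) fun _ => MaxTensorPower D n → D := ⟨fun f => f.1⟩

/-- The point-norm topology. -/
instance : TopologicalSpace (UnitalFullHom D n) :=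
  TopologicalSpace.induced (fun f => (f : MaxTensorPower D n → D)) Pi.topologicalSpace

end UnitalFullHom

/-! ## Operads in compactly generated weakly Hausdorff spaces -/

/-- A space is weakly Hausdorff if every continuous map from a compact Hausdorff space to it has
closed image. -/
def IsWeaklyHausdorff (X : Type u) [TopologicalSpace X] : Prop :=
  ∀ (K : Type u) [TopologicalSpace K] [CompactSpace K] [T2Space K] (f : K → X),
    Continuous f → IsClosed (Set.range f)

/-- The decomposition of `{0, …, n - 1}`, where `n = j₁ + ⋯ + jₖ`, into consecutive blocks of
lengths `j₁, …, jₖ`: the pair `⟨s, r⟩` is sent to the `r`-th element of the `s`-th block. -/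
def blockEquiv {k n : ℕ} (j : Fin k → ℕ) (h : ∑ s, j s = n) : (Σ s : Fin k, Fin (j s)) ≃ Fin n :=
  finSigmaFinEquiv.trans (finCongr h)

/-- For `σ ∈ Σₖ`, the permutation of `n = j₁ + ⋯ + jₖ` letters that moves the `s`-th block of the
decomposition into blocks of lengths `j_{σ(1)}, …, j_{σ(k)}` to the `σ(s)`-th block of the
decomposition into blocks of lengths `j₁, …, jₖ`, without changing the order inside the blocks. -/
def blockPerm {k n : ℕ} (j : Fin k → ℕ) (h : ∑ s, j s = n) (σ : Equiv.Perm (Fin k))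
    (h' : ∑ s, j (σ s) = n) : Equiv.Perm (Fin n) :=
  (blockEquiv (fun s => j (σ s)) h').symm.trans <|
    (Equiv.sigmaCongrLeft (β := fun s => Fin (j s)) σ).trans (blockEquiv j h)

/-- The permutation `τ₁ ⊕ ⋯ ⊕ τₖ` of `n = j₁ + ⋯ + jₖ` letters that acts by `τₛ` on the `s`-th
block. -/
def sumPerm {k n : ℕ} (j : Fin k → ℕ) (h : ∑ s, j s = n) (τ : ∀ s, Equiv.Perm (Fin (j s))) :
    Equiv.Perm (Fin n) :=
  (blockEquiv j h).symm.trans <| (Equiv.sigmaCongrRight τ).trans (blockEquiv j h)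

/-- The structure of a (symmetric) operad, in the sense of May, in the category of compactly
generated weakly Hausdorff spaces, on a sequence of spaces `C 0, C 1, …`. Products are taken in
this category, so the composition is continuous for the compactly generated topology on the product.
The composition is also given for `k = 0`, where it is the identity of `C 0` by `comp_one`. -/
structure OperadStructure (C : ℕ → Type u) [∀ n, TopologicalSpace (C n)] where
  compactlyGenerated : ∀ n, CompactlyGeneratedSpace (C n)
  weaklyHausdorff : ∀ n, IsWeaklyHausdorff (C n)
  /-- The right action of the symmetric group `Σₙ` on `C n`. -/
  act : ∀ {n : ℕ}, C n → Equiv.Perm (Fin n) → C n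
  /-- The unit. -/
  one : C 1
  /-- The composition `γ : C k × C j₁ × ⋯ × C jₖ → C n`, where `n = j₁ + ⋯ + jₖ`. -/
  comp : ∀ {k n : ℕ} (j : Fin k → ℕ), ∑ s, j s = n → C k → (∀ s, C (j s)) → C n
  continuous_act : ∀ {n : ℕ} (σ : Equiv.Perm (Fin n)), Continuous fun c : C n => act c σ
  continuous_comp : ∀ {k n : ℕ} (j : Fin k → ℕ) (h : ∑ s, j s = n),
    @Continuous _ _ (TopologicalSpace.compactlyGenerated.{u} (C k × ∀ s, C (j s))) _
      fun x : C k × ∀ s, C (j s) => comp j h x.1 x.2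
  act_one : ∀ {n : ℕ} (c : C n), act c 1 = c
  act_mul : ∀ {n : ℕ} (c : C n) (σ τ : Equiv.Perm (Fin n)), act c (σ * τ) = act (act c σ) τ
  /-- Left unitality: `γ(1; c) = c`. -/
  one_comp : ∀ {n : ℕ} (h : ∑ _s : Fin 1, n = n) (c : C n), comp (fun _ => n) h one (fun _ => c) = c
  /-- Right unitality: `γ(c; 1, …, 1) = c`. -/
  comp_one : ∀ {k : ℕ} (h : ∑ _s : Fin k, 1 = k) (c : C k), comp (fun _ => 1) h c (fun _ => one) = c
  /-- Associativity: `γ(γ(c; d₁, …, dₖ); e₁₁, …, e₁ⱼ₁, …, eₖ₁, …, eₖⱼₖ) = γ(c; f₁, …, fₖ)`, where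
  `fₛ = γ(dₛ; eₛ₁, …, eₛⱼₛ)`. -/
  assoc : ∀ {k m n : ℕ} (j : Fin k → ℕ) (h : ∑ s, j s = m)
    (i : ∀ s, Fin (j s) → ℕ) (l : Fin k → ℕ) (hl : ∀ s, ∑ r, i s r = l s) (hn : ∑ s, l s = n)
    (hn' : ∑ t : Fin m, i ((blockEquiv j h).symm t).1 ((blockEquiv j h).symm t).2 = n)
    (c : C k) (d : ∀ s, C (j s)) (e : ∀ s r, C (i s r)),
    comp (fun t => i ((blockEquiv j h).symm t).1 ((blockEquiv j h).symm t).2) hn' (comp j h c d)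
        (fun t => e ((blockEquiv j h).symm t).1 ((blockEquiv j h).symm t).2) =
      comp l hn c fun s => comp (i s) (hl s) (d s) (e s)
  /-- Equivariance in the first variable:
  `γ(c σ; d_{σ(1)}, …, d_{σ(k)}) = γ(c; d₁, …, dₖ) σ(j₁, …, jₖ)`. -/
  act_comp : ∀ {k n : ℕ} (j : Fin k → ℕ) (h : ∑ s, j s = n) (σ : Equiv.Perm (Fin k))
    (h' : ∑ s, j (σ s) = n) (c : C k) (d : ∀ s, C (j s)),
    comp (fun s => j (σ s)) h' (act c σ) (fun s => d (σ s)) =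
      act (comp j h c d) (blockPerm j h σ h')
  /-- Equivariance in the other variables:
  `γ(c; d₁ τ₁, …, dₖ τₖ) = γ(c; d₁, …, dₖ) (τ₁ ⊕ ⋯ ⊕ τₖ)`. -/
  comp_act : ∀ {k n : ℕ} (j : Fin k → ℕ) (h : ∑ s, j s = n) (τ : ∀ s, Equiv.Perm (Fin (j s)))
    (c : C k) (d : ∀ s, C (j s)),
    comp j h c (fun s => act (d s) (τ s)) = act (comp j h c d) (sumPerm j h τ)

end

/-! Fullness costs nothing here, so the spaces carry the operad structure of all unital
*-homomorphisms. This rests on simplicity of `D`. Let `φ : D ≅ D ⊗ D` with unitaries `uₙ` such that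
`uₙ φ(x) uₙ* → x ⊗ 1`, let `σ` be the flip, let `d` lie in a proper ideal `I`, and put `c = φ⁻¹(σ(φ
d))`. Flipping the limit for `c` and comparing it with the limit for `d` gives `zₙ (d ⊗ 1) zₙ* → 1 ⊗
c` with `zₙ = σ(uₙ) uₙ*`. If `c ≠ 0`, choose states `f` vanishing on `I` and `g` with `g(c* c) ≠ 0`.
After left multiplication by `1 ⊗ c*`, the product `f ⊗ g` kills the sequence but not its limit
(`eq_zero_of_tendsto`). So `c = 0` and `d = 0`. The product functional extends to the maximal tensor
product because it is positive (Schur product theorem) and its GNS seminorm is a C*-seminorm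
dominating it.

Iterating `D ≅ D ⊗ D` shows that every positive tensor power is a quotient of `D`. A unital map from
it to a nonzero `D` is then injective, and full by simplicity (`IsStronglySelfAbsorbing.isFullHom`).
The zeroth power consists of scalars.

For the topology, *-homomorphisms are contractive, so evaluation is jointly continuous and
continuity may be tested on a dense family of elementary tensors. By separability a sequence
suffices, so the spaces are first countable, hence compactly generated; they are also Hausdorff. The
operad axioms are compared on elementary tensors, where they become identities between block
decompositions of `Fin n`. -/

noncomputable section

/-! ## States on C*-algebras -/

section States

variable {A : Type u} [CStarAlgebra A]

theorem nontrivial_of_map_one_eq_one {f : A →ₗ[ℂ] ℂ} (h1 : f 1 = 1) : Nontrivial A := by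
  refine ⟨1, 0, fun h => ?_⟩
  rw [h, map_zero] at h1
  exact zero_ne_one h1

/-- C*-identity: for self-adjoint `a` the cross terms in `(a + it)* (a + it)` cancel, leaving `a² +
t²`. -/
theorem norm_add_mul_I_le [Nontrivial A] {a : A} (ha : IsSelfAdjoint a) (t : ℝ) :
    ‖a + ((t : ℂ) * Complex.I) • (1 : A)‖ ^ 2 ≤ ‖a‖ ^ 2 + t ^ 2 := by
  have h : star (a + ((t : ℂ) * Complex.I) • (1 : A)) * (a + ((t : ℂ) * Complex.I) • (1 : A)) =
      a * a + ((t : ℂ) ^ 2) • (1 : A) := by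
    have hs : ((t : ℂ) * Complex.I) * ((t : ℂ) * Complex.I) = -((t : ℂ) ^ 2) := by
      ring_nf; simp
    simp only [star_add, star_smul, star_one, ha.star_eq, add_mul, mul_add, smul_mul_assoc,
      mul_smul_comm, one_mul, mul_one, star_mul']
    have h1 : (star (t : ℂ) * star Complex.I) = -((t : ℂ) * Complex.I) := by simp
    have h2 : ((t : ℂ) * Complex.I) • ((t : ℂ) * Complex.I) • (1 : A) = -((t : ℂ) ^ 2 • (1 : A)) := by
      rw [smul_smul, hs, neg_smul]
    rw [h1, smul_add, neg_smul, neg_smul, smul_neg, h2]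
    abel
  rw [sq, ← CStarRing.norm_star_mul_self, h]
  refine (norm_add_le _ _).trans (add_le_add ?_ ?_)
  · rw [sq]; exact norm_mul_le _ _
  · rw [norm_smul]; simp

/-- A functional of norm at most `1` with `f 1 = 1` is real on self-adjoint elements. -/
theorem im_eq_zero_of_isSelfAdjoint {f : A →ₗ[ℂ] ℂ} (hf : ∀ a, ‖f a‖ ≤ ‖a‖) (h1 : f 1 = 1)
    {a : A} (ha : IsSelfAdjoint a) : (f a).im = 0 := by
  have := nontrivial_of_map_one_eq_one h1
  -- Test `f` on `a + it`: the terms `t²` cancel, and what remains is affine in `t`, hence unbounded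
  -- unless `Im f(a) = 0`.
  have key : ∀ t : ℝ, (f a).im ^ 2 + 2 * t * (f a).im ≤ ‖a‖ ^ 2 := by
    intro t
    have h2 := hf (a + ((t : ℂ) * Complex.I) • (1 : A))
    have h3 := norm_add_mul_I_le ha t
    rw [map_add, map_smul, h1, smul_eq_mul, mul_one] at h2
    have h4 : ((f a).im + t) ^ 2 ≤ ‖f a + (t : ℂ) * Complex.I‖ ^ 2 := by
      have := Complex.abs_im_le_norm (f a + (t : ℂ) * Complex.I)
      simp only [Complex.add_im, Complex.mul_im, Complex.ofReal_re, Complex.I_im, mul_one,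
        Complex.ofReal_im, Complex.I_re, mul_zero, add_zero] at this
      rw [← sq_abs]
      gcongr
    have h5 : ‖f a + (t : ℂ) * Complex.I‖ ^ 2 ≤ ‖a + ((t : ℂ) * Complex.I) • (1 : A)‖ ^ 2 := by
      gcongr
    nlinarith
  by_contra h
  have := key ((‖a‖ ^ 2 + 1) / (2 * (f a).im))
  have h6 : 2 * ((‖a‖ ^ 2 + 1) / (2 * (f a).im)) * (f a).im = ‖a‖ ^ 2 + 1 := by
    field_simp
  nlinarith [sq_nonneg (f a).im]

open scoped ComplexOrder in
/-- A functional of norm at most `1` with `f 1 = 1` is positive. -/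
theorem nonneg_apply_star_mul_self {f : A →ₗ[ℂ] ℂ} (hf : ∀ a, ‖f a‖ ≤ ‖a‖) (h1 : f 1 = 1)
    (a : A) : 0 ≤ f (star a * a) := by
  have := nontrivial_of_map_one_eq_one h1
  let _ : PartialOrder A := CStarAlgebra.spectralOrder A
  have _ : StarOrderedRing A := CStarAlgebra.spectralOrderedRing A
  have hsa : IsSelfAdjoint (star a * a) := .star_mul_self a
  rw [Complex.le_def]
  refine ⟨?_, (im_eq_zero_of_isSelfAdjoint hf h1 hsa).symm⟩
  set b := star a * a with hb
  have hb0 : 0 ≤ b := star_mul_self_nonneg a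
  -- From `0 ≤ ‖b‖ - b ≤ ‖b‖`. Applying `f` then gives `‖b‖ - Re f(b) ≤ ‖b‖`.
  have h2 : ‖(‖b‖ : ℂ) • (1 : A) - b‖ ≤ ‖b‖ := by
    have h3 : (‖b‖ : ℂ) • (1 : A) = algebraMap ℝ A ‖b‖ := by
      rw [Algebra.algebraMap_eq_smul_one, Complex.coe_smul]
    rw [h3]
    have h4 : 0 ≤ algebraMap ℝ A ‖b‖ - b := sub_nonneg.2 hsa.le_algebraMap_norm_self
    rw [CStarAlgebra.norm_le_iff_le_algebraMap _ (norm_nonneg b) h4]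
    exact sub_le_self _ hb0
  have h3 := hf ((‖b‖ : ℂ) • (1 : A) - b)
  rw [map_sub, map_smul, h1, smul_eq_mul, mul_one] at h3
  have h4 := (Complex.re_le_norm _).trans (h3.trans h2)
  simp only [Complex.sub_re, Complex.ofReal_re] at h4
  simpa using h4

/-- A state: a functional of norm at most `1` with `f 1 = 1`. -/
structure IsState (f : A →ₗ[ℂ] ℂ) : Prop where
  norm_apply_le : ∀ a, ‖f a‖ ≤ ‖a‖
  map_one : f 1 = 1

/-- A subspace that contains no invertible elements is annihilated by a state. -/
theorem exists_isState_of_not_isUnit (M : Submodule ℂ A) (hM : ∀ x ∈ M, ¬ IsUnit x) :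
    ∃ f : A →ₗ[ℂ] ℂ, IsState f ∧ ∀ x ∈ M, f x = 0 := by
  have : Nontrivial A := by
    by_contra h
    rw [not_nontrivial_iff_subsingleton] at h
    exact hM 0 M.zero_mem (isUnit_of_subsingleton 0)
  -- The distance from `1` to `M` is `1`, since anything strictly closer to `1` is invertible by the
  -- Neumann series. The state is a norming functional of the class of `1`, pulled back from the
  -- quotient.
  have h1 : ‖M.mkQ 1‖ = 1 := by
    refine le_antisymm ((Submodule.Quotient.norm_mk_le M 1).trans norm_one.le) ?_
    rw [Submodule.mkQ_apply]
    refine le_of_forall_pos_le_add fun ε hε => ?_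
    obtain ⟨m, hm, hlt⟩ := Submodule.Quotient.norm_mk_lt (S := M) (Submodule.Quotient.mk 1) hε
    rw [Submodule.Quotient.eq] at hm
    refine le_trans ?_ hlt.le
    by_contra! h
    refine hM _ hm ?_
    simpa using (Units.oneSub m h).isUnit.neg
  obtain ⟨g, hg, hg1⟩ := exists_dual_vector ℂ (M.mkQ 1) (by rw [h1]; exact one_ne_zero)
  refine ⟨g.toLinearMap ∘ₗ M.mkQ, ⟨fun a => ?_, ?_⟩, fun x hx => ?_⟩
  · refine (g.le_opNorm _).trans ?_
    rw [hg, one_mul]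
    exact Submodule.Quotient.norm_mk_le M a
  · rw [h1] at hg1
    simpa using hg1
  · have : M.mkQ x = 0 := by simpa using hx
    rw [LinearMap.comp_apply, this, map_zero]

/-- For every `a ≠ 0` there is a state that does not vanish at `a* a`. -/
theorem exists_isState_star_mul_self_ne_zero {a : A} (ha : a ≠ 0) :
    ∃ f : A →ₗ[ℂ] ℂ, IsState f ∧ f (star a * a) ≠ 0 := by
  have : Nontrivial A := ⟨a, 0, ha⟩
  let _ : PartialOrder A := CStarAlgebra.spectralOrder A
  have _ : StarOrderedRing A := CStarAlgebra.spectralOrderedRing A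
  set b := star a * a with hb
  have hsa : IsSelfAdjoint b := .star_mul_self a
  have hb0 : ‖b‖ ≠ 0 := by rw [hb, CStarRing.norm_star_mul_self]; simpa using ha
  have hspec : ‖b‖ ∈ spectrum ℝ b :=
    CStarAlgebra.norm_mem_spectrum_of_nonneg (star_mul_self_nonneg a)
  rw [spectrum.mem_iff] at hspec
  set c := algebraMap ℝ A ‖b‖ - b with hc
  have hcsa : IsSelfAdjoint c := (IsSelfAdjoint.algebraMap A (.all _)).sub hsa
  -- The right ideal `cA` has no units: if `c x` were invertible, `c` would have a right inverse
  -- and, being self-adjoint, a left one. A state killing `c` takes the value `‖b‖` at `b`.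
  obtain ⟨f, hf, hfM⟩ := exists_isState_of_not_isUnit (LinearMap.range (LinearMap.mulLeft ℂ c)) (by
    rintro _ ⟨x, rfl⟩ hx
    rw [LinearMap.mulLeft_apply] at hx
    refine hspec ?_
    obtain ⟨u, hu⟩ := hx
    have h1 : c * (x * ↑u⁻¹) = 1 := by rw [← mul_assoc, ← hu, Units.mul_inv]
    have h2 : star (x * ↑u⁻¹) * c = 1 := by
      have := congrArg star h1
      rwa [star_mul, hcsa.star_eq, star_one] at this
    rw [isUnit_iff_exists]
    exact ⟨_, h1, by rwa [left_inv_eq_right_inv h2 h1] at h2⟩)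
  refine ⟨f, hf, ?_⟩
  have h1 : f c = 0 := hfM _ ⟨1, by simp⟩
  rw [hc, Algebra.algebraMap_eq_smul_one, map_sub, ← Complex.coe_smul, map_smul,
    hf.map_one, sub_eq_zero] at h1
  rw [← h1]
  simpa using hb0

end States

/-! ## C*-seminorms from positive functionals -/

section GNS

open scoped ComplexOrder InnerProductSpace

variable {R : Type w} [Ring R] [StarRing R] [Algebra ℂ R] [StarModule ℂ R]

/-- A positive functional on a *-algebra for which left multiplications are bounded. -/
structure IsBoundedPositive (F : R →ₗ[ℂ] ℂ) : Prop where
  nonneg : ∀ x, 0 ≤ F (star x * x)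
  bounded : ∀ x, ∃ C : ℝ, ∀ y, (F (star (x * y) * (x * y))).re ≤ C * (F (star y * y)).re

/-- Polarization: `F (z* z)` is real for `z = x + y` and for `z = x + iy`. -/
theorem conj_apply_star_mul {F : R →ₗ[ℂ] ℂ} (hF : ∀ x, 0 ≤ F (star x * x)) (x y : R) :
    (starRingEnd ℂ) (F (star y * x)) = F (star x * y) := by
  have h0 : ∀ z, (F (star z * z)).im = 0 := fun z => ((Complex.le_def.1 (hF z)).2).symm
  have h1 := h0 (x + y)
  have h2 := h0 (x + Complex.I • y)
  simp only [star_add, star_smul, add_mul, mul_add, map_add, smul_mul_assoc, mul_smul_comm,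
    map_smul, smul_eq_mul, Complex.add_im, h0, Complex.mul_im, Complex.star_def, Complex.conj_I,
    Complex.neg_re, Complex.neg_im, Complex.I_re, Complex.I_im, Complex.mul_re] at h1 h2
  apply Complex.ext
  · simp only [Complex.conj_re]; linarith
  · simp only [Complex.conj_im]; linarith

/-- The semi-inner product `⟪x, y⟫ = F (x* y)` of a positive functional `F`. -/
abbrev preInnerProductCore {F : R →ₗ[ℂ] ℂ} (hF : ∀ x, 0 ≤ F (star x * x)) :
    PreInnerProductSpace.Core ℂ R where
  inner x y := F (star x * y)
  conj_inner_symm x y := conj_apply_star_mul hF x y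
  re_inner_nonneg x := (Complex.le_def.1 (hF x)).1
  add_left x y z := by rw [star_add, add_mul, map_add]
  smul_left x y r := by simp

/-- A bounded positive functional `F` with `F 1 = 1` is dominated by a C*-seminorm, the operator
seminorm of the GNS representation. -/
theorem IsBoundedPositive.exists_cstarSeminorm {F : R →ₗ[ℂ] ℂ} (hF : IsBoundedPositive F)
    (h1 : F 1 = 1) : ∃ p : CStarSeminorm R, ∀ x, ‖F x‖ ≤ p x := by
  -- Only an operator seminorm is wanted, so `R` itself with its semi-inner product replaces the GNS
  -- Hilbert space; neither a quotient nor a completion is taken.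
  let c := preInnerProductCore hF.nonneg
  let _ : SeminormedAddCommGroup R := InnerProductSpace.Core.toSeminormedAddCommGroup (c := c)
  let _ : InnerProductSpace ℂ R := InnerProductSpace.ofCore c
  have hin : ∀ x y : R, ⟪x, y⟫_ℂ = F (star x * y) := fun _ _ => rfl
  have hsq : ∀ x : R, ‖x‖ ^ 2 = (F (star x * x)).re := fun x => by
    rw [← hin, ← inner_self_eq_norm_sq (𝕜 := ℂ)]; rfl
  have hb : ∀ x : R, ∃ C : ℝ, ∀ y : R, ‖x * y‖ ≤ C * ‖y‖ := fun x => by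
    obtain ⟨C, hC⟩ := hF.bounded x
    refine ⟨√|C|, fun y => ?_⟩
    refine (sq_le_sq₀ (norm_nonneg _) (by positivity)).1 ?_
    rw [mul_pow, Real.sq_sqrt (abs_nonneg C), hsq, hsq]
    exact (hC y).trans (mul_le_mul_of_nonneg_right (le_abs_self C) (by rw [← hsq]; positivity))
  let L : R → (R →L[ℂ] R) := fun x => (LinearMap.mulLeft ℂ x).mkContinuousOfExistsBound (hb x)
  have hL : ∀ x y, L x y = x * y := fun _ _ => rfl
  have hmul : ∀ x y, ‖L (x * y)‖ ≤ ‖L x‖ * ‖L y‖ := fun x y => by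
    have : L (x * y) = (L x).comp (L y) := by ext z; simp [hL, mul_assoc]
    rw [this]
    exact ContinuousLinearMap.opNorm_comp_le _ _
  -- Cauchy–Schwarz applied to `‖x y‖² = ⟪y, x* x y⟫`; this replaces the use of adjoint operators.
  have hstar : ∀ x, ‖L x‖ * ‖L x‖ ≤ ‖L (star x * x)‖ := fun x => by
    rw [← sq, ← Real.le_sqrt (norm_nonneg _) (norm_nonneg _)]
    refine ContinuousLinearMap.opNorm_le_bound _ (Real.sqrt_nonneg _) fun y => ?_
    refine (sq_le_sq₀ (norm_nonneg _) (by positivity)).1 ?_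
    rw [mul_pow, Real.sq_sqrt (norm_nonneg _), hL, hsq, star_mul, mul_assoc, ← mul_assoc (star x),
      ← hL (star x * x), ← hin]
    refine (Complex.re_le_norm _).trans ((norm_inner_le_norm _ _).trans ?_)
    calc ‖y‖ * ‖L (star x * x) y‖ ≤ ‖y‖ * (‖L (star x * x)‖ * ‖y‖) := by
          gcongr; exact ContinuousLinearMap.le_opNorm _ _
      _ = _ := by ring
  have hle : ∀ x, ‖L x‖ ≤ ‖L (star x)‖ := fun x => by
    rcases (norm_nonneg (L x)).eq_or_lt with h | h
    · rw [← h]; exact norm_nonneg _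
    · exact le_of_mul_le_mul_right ((hstar x).trans (hmul _ _)) h
  refine ⟨{ toFun := fun x => ‖L x‖
            map_zero' := ?_
            add_le' := fun x y => ?_
            neg' := fun x => ?_
            smul' := fun a x => ?_
            mul_le' := hmul
            star_mul_self' := fun x => le_antisymm ((hmul _ _).trans ?_) (hstar x) }, fun x => ?_⟩
  · have : L 0 = 0 := by ext z; simp [hL]
    rw [this, norm_zero]
  · have : L (x + y) = L x + L y := by ext z; simp [hL, add_mul]
    rw [this]; exact norm_add_le _ _
  · have : L (-x) = -L x := by ext z; simp [hL]
    rw [this, norm_neg]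
  · have : L (a • x) = a • L x := by ext z; simp [hL]
    rw [this, norm_smul]
  · gcongr
    simpa using hle (star x)
  · change ‖F x‖ ≤ ‖L x‖
    have hn : ‖(1 : R)‖ = 1 := by
      rw [← sq_eq_sq₀ (norm_nonneg _) zero_le_one, hsq]; simp [h1]
    -- `F` is the vector state of `1`, a vector of norm `1` because `F 1 = 1`.
    have : F x = ⟪(1 : R), L x 1⟫_ℂ := by rw [hin, hL, star_one, one_mul, mul_one]
    rw [this]
    refine (norm_inner_le_norm _ _).trans ?_
    rw [hn, one_mul]
    simpa [hn] using (L x).le_opNorm 1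

end GNS

/-! ## Product states -/

section ProductState

open scoped ComplexOrder
open PiTensorProduct

variable {ι : Type v} {A : ι → Type w} [∀ i, CStarAlgebra (A i)]

theorem star_singleAlgHom [DecidableEq ι] (i : ι) (x : A i) :
    star (singleAlgHom (R := ℂ) (A := A) i x) = singleAlgHom (R := ℂ) i (star x) := by
  simp only [singleAlgHom_apply, star_tprod, MonoidHom.mulSingle_apply, Pi.mulSingle,
    ← Function.update_star, star_one]

/-- The functional `⨂ aᵢ ↦ ∏ fᵢ(aᵢ)` on the algebraic tensor product. -/
def prodFunctional [Fintype ι] (f : ∀ i, A i →ₗ[ℂ] ℂ) : (⨂[ℂ] i, A i) →ₗ[ℂ] ℂ :=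
  lift ((MultilinearMap.mkPiAlgebra ℂ ι ℂ).compLinearMap f)

theorem prodFunctional_tprod [Fintype ι] (f : ∀ i, A i →ₗ[ℂ] ℂ) (a : ∀ i, A i) :
    prodFunctional f (tprod ℂ a) = ∏ i, f i (a i) := by
  simp [prodFunctional]

theorem posSemidef_apply_star_mul {κ : Type*} {B : Type*} [CStarAlgebra B] {f : B →ₗ[ℂ] ℂ}
    (hf : ∀ a, 0 ≤ f (star a * a)) (b : κ → B) :
    (Matrix.of fun k l => f (star (b k) * b l)).PosSemidef := by
  refine ⟨?_, fun c => ?_⟩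
  · ext k l
    exact conj_apply_star_mul hf _ _
  · have := hf (c.sum fun k r => r • b k)
    convert this using 1
    simp only [Finsupp.sum, star_sum, Finset.sum_mul, Finset.mul_sum, map_sum, star_smul,
      smul_mul_assoc, mul_smul_comm, map_smul, smul_eq_mul, Matrix.of_apply]
    rw [Finset.sum_comm]
    refine Finset.sum_congr rfl fun k _ => Finset.sum_congr rfl fun l _ => by ring

/-- For a combination `x` of elementary tensors, the value at `x* x` is a quadratic form whose
matrix is the entrywise product of the Gram matrices of the `f i`. This is positive semidefinite by
the Schur product theorem. -/
theorem prodFunctional_nonneg [Fintype ι] {f : ∀ i, A i →ₗ[ℂ] ℂ}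
    (hf : ∀ i a, 0 ≤ f i (star a * a)) (x : ⨂[ℂ] i, A i) : 0 ≤ prodFunctional f (star x * x) := by
  classical
  -- The matrices are indexed by all families `a`. The induction adds one factor at a time and
  -- starts from the all-ones matrix.
  have hM : ∀ s : Finset ι, (Matrix.of fun a b : ∀ i, A i =>
      ∏ i ∈ s, f i (star (a i) * b i)).PosSemidef := by
    intro s
    induction s using Finset.induction_on with
    | empty =>
      simp only [Finset.prod_empty]
      refine ⟨by ext; simp, fun c => ?_⟩
      have : 0 ≤ star (c.sum fun _ r => r) * (c.sum fun _ r => r) := star_mul_self_nonneg _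
      convert this using 1
      simp only [Finsupp.sum, star_sum, Finset.sum_mul, Finset.mul_sum, Matrix.of_apply, mul_one]
      rw [Finset.sum_comm]
    | insert i s hi ih =>
      have h := (posSemidef_apply_star_mul (hf i) fun a : ∀ i, A i => a i).hadamard ih
      have e : (Matrix.of fun a b : ∀ i, A i => ∏ j ∈ insert i s, f j (star (a j) * b j)) =
          (Matrix.of fun a b : ∀ i, A i => f i (star (a i) * b i)).hadamard
            (Matrix.of fun a b : ∀ i, A i => ∏ j ∈ s, f j (star (a j) * b j)) := by
        ext a b
        simp [Finset.prod_insert hi]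
      rw [e]
      exact h
  have hx : x ∈ Submodule.span ℂ (Set.range (tprod ℂ (s := A))) := by
    rw [span_tprod_eq_top]; trivial
  obtain ⟨c, rfl⟩ := (Finsupp.mem_span_range_iff_exists_finsupp).1 hx
  have := (hM Finset.univ).2 c
  convert this using 1
  simp only [Finsupp.sum, star_sum, Finset.sum_mul, Finset.mul_sum, map_sum, star_smul, star_tprod,
    smul_mul_assoc, mul_smul_comm, map_smul, smul_eq_mul, Matrix.of_apply, tprod_mul_tprod,
    prodFunctional_tprod, Pi.mul_apply, Pi.star_apply]
  rw [Finset.sum_comm]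
  refine Finset.sum_congr rfl fun k _ => Finset.sum_congr rfl fun l _ => by ring

/-- Write `‖a‖² - a* a = b* b` in the factor `A i` and use positivity of `F` at `b y`. -/
theorem singleAlgHom_mul_le [DecidableEq ι] {F : (⨂[ℂ] i, A i) →ₗ[ℂ] ℂ}
    (hF : ∀ x, 0 ≤ F (star x * x)) (i : ι) (a : A i) (y : ⨂[ℂ] i, A i) :
    (F (star (singleAlgHom i a * y) * (singleAlgHom i a * y))).re ≤
      ‖a‖ ^ 2 * (F (star y * y)).re := by
  let _ : PartialOrder (A i) := CStarAlgebra.spectralOrder (A i)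
  have _ : StarOrderedRing (A i) := CStarAlgebra.spectralOrderedRing (A i)
  have key : ∀ b : A i, F (star (singleAlgHom i b * y) * (singleAlgHom i b * y)) =
      F (star y * singleAlgHom i (star b * b) * y) := fun b => by
    rw [star_mul, star_singleAlgHom, map_mul (singleAlgHom i)]
    simp only [mul_assoc]
  have h1 : star a * a ≤ algebraMap ℝ (A i) (‖a‖ ^ 2) := by
    have := (IsSelfAdjoint.star_mul_self a).le_algebraMap_norm_self
    rwa [CStarRing.norm_star_mul_self, ← sq] at this
  obtain ⟨b, hb⟩ := CStarAlgebra.nonneg_iff_eq_star_mul_self.1 (sub_nonneg.2 h1)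
  have h2 := (Complex.le_def.1 (hF (singleAlgHom i b * y))).1
  have h3 : algebraMap ℝ (A i) (‖a‖ ^ 2) = ((‖a‖ ^ 2 : ℝ) : ℂ) • (1 : A i) := by
    rw [Algebra.algebraMap_eq_smul_one, Complex.coe_smul]
  rw [key, ← hb, map_sub, h3, map_smul, map_one, mul_sub, sub_mul, map_sub, ← key, mul_smul_comm,
    mul_one, smul_mul_assoc, map_smul, smul_eq_mul, Complex.sub_re, Complex.re_ofReal_mul] at h2
  simpa using h2

/-- Boundedness is automatic on a tensor product of C*-algebras: elementary tensors are products of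
single-factor elements, which `singleAlgHom_mul_le` bounds, and sums are handled by the
parallelogram law. -/
theorem isBoundedPositive_of_nonneg [Finite ι] {F : (⨂[ℂ] i, A i) →ₗ[ℂ] ℂ}
    (hF : ∀ x, 0 ≤ F (star x * x)) : IsBoundedPositive F := by
  classical
  have := Fintype.ofFinite ι
  have hre : ∀ x, 0 ≤ (F (star x * x)).re := fun x => (Complex.le_def.1 (hF x)).1
  refine ⟨hF, fun x => ?_⟩
  induction x using PiTensorProduct.induction_on with
  | add x x' hx hx' =>
    obtain ⟨C, hC⟩ := hx
    obtain ⟨C', hC'⟩ := hx'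
    refine ⟨2 * C + 2 * C', fun y => ?_⟩
    have h1 := hC y
    have h2 := hC' y
    have h3 := hre (x * y - x' * y)
    have h4 : star ((x + x') * y) * ((x + x') * y) + star (x * y - x' * y) * (x * y - x' * y) =
        (2 : ℂ) • (star (x * y) * (x * y)) + (2 : ℂ) • (star (x' * y) * (x' * y)) := by
      rw [add_mul, star_add, star_sub, two_smul, two_smul]
      noncomm_ring
    have h5 := congrArg (fun z => (F z).re) h4
    simp only [map_add, map_smul, smul_eq_mul, Complex.add_re, Complex.mul_re, Complex.re_ofNat,
      Complex.im_ofNat, zero_mul, sub_zero] at h5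
    nlinarith
  | smul_tprod r a =>
    have key : ∀ s : Finset ι, ∃ C : ℝ, 0 ≤ C ∧ ∀ y, (F (star (tprod ℂ (s.piecewise a 1) * y) *
        (tprod ℂ (s.piecewise a 1) * y))).re ≤ C * (F (star y * y)).re := by
      intro s
      induction s using Finset.induction_on with
      | empty =>
        refine ⟨1, zero_le_one, fun y => ?_⟩
        rw [Finset.piecewise_empty, ← one_def, one_mul, one_mul]
      | insert i s hi ih =>
        obtain ⟨C, hC0, hC⟩ := ih
        have h : tprod ℂ ((insert i s).piecewise a 1) =
            singleAlgHom (R := ℂ) (A := A) i (a i) * tprod ℂ (s.piecewise a 1) := by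
          rw [singleAlgHom_apply, tprod_mul_tprod]
          congr 1
          ext j
          by_cases hj : j = i
          · subst hj
            simp [hi]
          · simp [Finset.piecewise, hj]
        refine ⟨‖a i‖ ^ 2 * C, by positivity, fun y => ?_⟩
        rw [h, mul_assoc, mul_assoc]
        exact (singleAlgHom_mul_le hF i (a i) _).trans
          (mul_le_mul_of_nonneg_left (hC y) (by positivity))
    obtain ⟨C, -, hC⟩ := key Finset.univ
    refine ⟨‖r‖ ^ 2 * C, fun y => ?_⟩
    have h1 := hC y
    rw [Finset.piecewise_univ] at h1
    have h2 : F (star (r • tprod ℂ a * y) * (r • tprod ℂ a * y)) =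
        ((‖r‖ ^ 2 : ℝ) : ℂ) * F (star (tprod ℂ a * y) * (tprod ℂ a * y)) := by
      rw [smul_mul_assoc, star_smul, smul_mul_smul_comm, map_smul, smul_eq_mul, Complex.star_def,
        Complex.conj_mul']
      push_cast
      rfl
    rw [h2, Complex.re_ofReal_mul, mul_assoc]
    exact mul_le_mul_of_nonneg_left h1 (by positivity)

/-- A product of states is dominated by the maximal C*-norm. -/
theorem norm_prodFunctional_le [Fintype ι] {f : ∀ i, A i →ₗ[ℂ] ℂ} (hf : ∀ i, IsState (f i))
    (x : ⨂[ℂ] i, A i) : ‖prodFunctional f x‖ ≤ maxCStarSeminorm A x := by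
  have hF := prodFunctional_nonneg fun i =>
    nonneg_apply_star_mul_self (hf i).norm_apply_le (hf i).map_one
  -- The GNS seminorm takes part in the supremum defining the maximal norm.
  obtain ⟨p, hp⟩ := (isBoundedPositive_of_nonneg hF).exists_cstarSeminorm (by
    rw [one_def, prodFunctional_tprod]
    simp [(hf _).map_one])
  exact (hp x).trans (le_ciSup (CStarSeminorm.bddAbove_tensor x) p)

end ProductState

/-! ## The universal property of the maximal tensor product -/

namespace CStarSeminorm

variable {R : Type w} [Ring R] [StarRing R] [Algebra ℂ R]

theorem continuous_of_norm_le {E : Type*} [NormedAddCommGroup E] [NormedSpace ℂ E]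
    (p : CStarSeminorm R) (T : R →ₗ[ℂ] E) (hT : ∀ x, ‖T x‖ ≤ p x) :
    UniformContinuous (fun x : p.Carrier => T x) := by
  let T' : p.Carrier →ₗ[ℂ] E := T
  exact (T'.mkContinuous 1 fun x => by rw [one_mul]; exact hT x).uniformContinuous

/-- The extension to the completion of a linear map that is bounded for the seminorm. -/
def extend {E : Type*} [NormedAddCommGroup E] [NormedSpace ℂ E] [CompleteSpace E]
    (p : CStarSeminorm R) (T : R →ₗ[ℂ] E) (x : p.Compl) : E :=
  UniformSpace.Completion.extension (fun x : p.Carrier => T x) x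

section Extend

variable {E : Type*} [NormedAddCommGroup E] [NormedSpace ℂ E] [CompleteSpace E]
  (p : CStarSeminorm R) (T : R →ₗ[ℂ] E)

theorem continuous_extend : Continuous (p.extend T) :=
  UniformSpace.Completion.continuous_extension

theorem extend_toCompl (hT : ∀ x, ‖T x‖ ≤ p x) (x : R) : p.extend T (p.toCompl x) = T x :=
  UniformSpace.Completion.extension_coe (p.continuous_of_norm_le T hT) (p.toCarrier x)

end Extend

variable [StarModule ℂ R] {B : Type u} [CStarAlgebra B]

/-- The C*-seminorm `x ↦ ‖π x‖`. -/
def ofStarAlgHom (π : R →⋆ₐ[ℂ] B) : CStarSeminorm R where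
  toSeminorm := (normSeminorm ℂ B).comp π.toAlgHom.toLinearMap
  mul_le' x y := by
    change ‖π (x * y)‖ ≤ ‖π x‖ * ‖π y‖
    rw [map_mul]
    exact norm_mul_le _ _
  star_mul_self' x := by
    change ‖π (star x * x)‖ = ‖π x‖ * ‖π x‖
    rw [map_mul, StarHomClass.map_star, CStarRing.norm_star_mul_self]

/-- The extension to the completion of a *-homomorphism that is bounded for the seminorm. -/
def lift (p : CStarSeminorm R) (π : R →⋆ₐ[ℂ] B) (h : ∀ x, ‖π x‖ ≤ p x) : p.Compl →⋆ₐ[ℂ] B where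
  toFun := p.extend π.toAlgHom.toLinearMap
  map_one' := by rw [← p.toCompl_one, p.extend_toCompl π.toAlgHom.toLinearMap h]; exact map_one π
  map_zero' := by rw [← p.toCompl_zero, p.extend_toCompl π.toAlgHom.toLinearMap h]; exact map_zero π
  map_mul' x y := by
    have hc := p.continuous_extend π.toAlgHom.toLinearMap
    induction x, y using p.denseRange_toCompl.induction_on₂ with
    | hp =>
      exact isClosed_eq (hc.comp continuous_mul)
        ((hc.comp continuous_fst).mul (hc.comp continuous_snd))
    | h x y =>
      simp only [← toCompl_mul, p.extend_toCompl π.toAlgHom.toLinearMap h]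
      exact map_mul π x y
  map_add' x y := by
    have hc := p.continuous_extend π.toAlgHom.toLinearMap
    induction x, y using p.denseRange_toCompl.induction_on₂ with
    | hp =>
      exact isClosed_eq (hc.comp continuous_add)
        ((hc.comp continuous_fst).add (hc.comp continuous_snd))
    | h x y =>
      simp only [← toCompl_add, p.extend_toCompl π.toAlgHom.toLinearMap h]
      exact map_add π x y
  commutes' c := by
    rw [Algebra.algebraMap_eq_smul_one, ← toCompl_one, ← toCompl_smul, p.extend_toCompl _ h,
      Algebra.algebraMap_eq_smul_one, map_smul]
    exact congrArg (c • ·) (map_one π)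
  map_star' x := by
    have hc := p.continuous_extend π.toAlgHom.toLinearMap
    induction x using p.denseRange_toCompl.induction_on with
    | hp => exact isClosed_eq (hc.comp p.continuous_star_compl) (continuous_star.comp hc)
    | ih x =>
      simp only [← toCompl_star, p.extend_toCompl π.toAlgHom.toLinearMap h]
      exact StarHomClass.map_star π x

theorem lift_toCompl (p : CStarSeminorm R) (π : R →⋆ₐ[ℂ] B) (h : ∀ x, ‖π x‖ ≤ p x) (x : R) :
    p.lift π h (p.toCompl x) = π x :=
  p.extend_toCompl π.toAlgHom.toLinearMap h x

end CStarSeminorm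

section UniversalProperty

open PiTensorProduct

variable {ι : Type v} {A : ι → Type w} [∀ i, CStarAlgebra (A i)] [Finite ι]
  {B : Type u} [CStarAlgebra B]

theorem StarAlgHom.continuous_of_cstar {A B : Type*} [CStarAlgebra A] [CStarAlgebra B]
    (f : A →⋆ₐ[ℂ] B) : Continuous f :=
  AddMonoidHomClass.continuous_of_bound f 1 fun a => by
    rw [one_mul]; exact NonUnitalStarAlgHom.norm_apply_le f a

/-- `maxTprod` as a multilinear map. -/
def maxTprodMultilinear (A : ι → Type w) [∀ i, CStarAlgebra (A i)] :
    MultilinearMap ℂ A (MaxTensorProduct A) :=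
  LinearMap.compMultilinearMap
    { toFun := (maxCStarSeminorm A).toCompl
      map_add' := (maxCStarSeminorm A).toCompl_add
      map_smul' := (maxCStarSeminorm A).toCompl_smul } (tprod ℂ)

theorem maxTprodMultilinear_apply (a : ∀ i, A i) : maxTprodMultilinear A a = maxTprod a := rfl

theorem maxTprod_mul (a b : ∀ i, A i) : maxTprod (a * b) = maxTprod a * maxTprod b := by
  rw [maxTprod, maxTprod, maxTprod, ← CStarSeminorm.toCompl_mul, tprod_mul_tprod]

theorem maxTprod_star (a : ∀ i, A i) : maxTprod (star a) = star (maxTprod a) := by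
  rw [maxTprod, maxTprod, ← CStarSeminorm.toCompl_star, star_tprod]

theorem maxTprod_one : maxTprod (1 : ∀ i, A i) = 1 := rfl

/-- A closed subspace that contains all elementary tensors is everything. -/
theorem mem_of_maxTprod_mem {S : Submodule ℂ (MaxTensorProduct A)}
    (hS : IsClosed (S : Set (MaxTensorProduct A)))
    (h : ∀ a : ∀ i, A i, maxTprod a ∈ S) (x : MaxTensorProduct A) : x ∈ S := by
  induction x using (maxCStarSeminorm A).denseRange_toCompl.induction_on with
  | hp => exact hS
  | ih x =>
    induction x using PiTensorProduct.induction_on with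
    | smul_tprod r a =>
      rw [CStarSeminorm.toCompl_smul]
      exact S.smul_mem r (h a)
    | add x y hx hy =>
      rw [CStarSeminorm.toCompl_add]
      exact S.add_mem hx hy

/-- Two continuous linear maps that agree on elementary tensors are equal. -/
theorem eq_of_eq_on_maxTprod {E F G : Type*} [AddCommGroup E] [Module ℂ E] [TopologicalSpace E]
    [T2Space E] [FunLike F (MaxTensorProduct A) E] [LinearMapClass F ℂ (MaxTensorProduct A) E]
    [FunLike G (MaxTensorProduct A) E] [LinearMapClass G ℂ (MaxTensorProduct A) E]
    {f : F} {g : G} (hf : Continuous f) (hg : Continuous g)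
    (h : ∀ a : ∀ i, A i, f (maxTprod a) = g (maxTprod a)) (x : MaxTensorProduct A) : f x = g x := by
  let S : Submodule ℂ (MaxTensorProduct A) :=
    LinearMap.eqLocus (f : MaxTensorProduct A →ₗ[ℂ] E) (g : MaxTensorProduct A →ₗ[ℂ] E)
  exact mem_of_maxTprod_mem (S := S) (isClosed_eq hf hg) h x

theorem starAlgHom_ext_maxTprod {f g : MaxTensorProduct A →⋆ₐ[ℂ] B}
    (h : ∀ a : ∀ i, A i, f (maxTprod a) = g (maxTprod a)) : f = g :=
  StarAlgHom.ext (eq_of_eq_on_maxTprod f.continuous_of_cstar g.continuous_of_cstar h)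

/-- The *-homomorphism on the algebraic tensor product given by a multiplicative *-preserving
multilinear map. -/
def tensorLift (f : MultilinearMap ℂ A B) (one : f 1 = 1) (mul : ∀ x y, f (x * y) = f x * f y)
    (star' : ∀ x, f (star x) = star (f x)) : (⨂[ℂ] i, A i) →⋆ₐ[ℂ] B :=
  { liftAlgHom f one mul with
    map_star' := fun x => by
      change PiTensorProduct.lift f (star x) = star (PiTensorProduct.lift f x)
      induction x using PiTensorProduct.induction_on with
      | smul_tprod r a =>
        rw [star_smul_tprod, map_smul, map_smul, lift.tprod, lift.tprod, star', star_smul]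
      | add x y hx hy => rw [star_add, map_add, hx, hy, map_add, star_add] }

/-- The *-homomorphism on the maximal tensor product given by a multiplicative *-preserving
multilinear map. -/
def maxLift (f : MultilinearMap ℂ A B) (one : f 1 = 1) (mul : ∀ x y, f (x * y) = f x * f y)
    (star' : ∀ x, f (star x) = star (f x)) : MaxTensorProduct A →⋆ₐ[ℂ] B :=
  (maxCStarSeminorm A).lift (tensorLift f one mul star') fun x =>
    -- The required bound: `x ↦ ‖π x‖` is one of the C*-seminorms whose supremum is the maximal
    -- norm.
    le_ciSup (CStarSeminorm.bddAbove_tensor x)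
      (CStarSeminorm.ofStarAlgHom (tensorLift f one mul star'))

theorem maxLift_maxTprod (f : MultilinearMap ℂ A B) (one : f 1 = 1)
    (mul : ∀ x y, f (x * y) = f x * f y) (star' : ∀ x, f (star x) = star (f x)) (a : ∀ i, A i) :
    maxLift f one mul star' (maxTprod a) = f a :=
  ((maxCStarSeminorm A).lift_toCompl (tensorLift f one mul star') (fun x =>
    le_ciSup (CStarSeminorm.bddAbove_tensor x)
      (CStarSeminorm.ofStarAlgHom (tensorLift f one mul star'))) (tprod ℂ a)).trans (lift.tprod a)

/-- The embedding of a tensor factor. -/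
def maxSingle [DecidableEq ι] (i : ι) : A i →⋆ₐ[ℂ] MaxTensorProduct A where
  toFun a := (maxCStarSeminorm A).toCompl (singleAlgHom (R := ℂ) i a)
  map_one' := by rw [map_one, CStarSeminorm.toCompl_one]
  map_mul' x y := by rw [map_mul, CStarSeminorm.toCompl_mul]
  map_zero' := by rw [map_zero, CStarSeminorm.toCompl_zero]
  map_add' x y := by rw [map_add, CStarSeminorm.toCompl_add]
  commutes' c := by
    rw [AlgHom.commutes, Algebra.algebraMap_eq_smul_one, CStarSeminorm.toCompl_smul,
      CStarSeminorm.toCompl_one, Algebra.algebraMap_eq_smul_one]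
  map_star' x := by rw [← star_singleAlgHom, CStarSeminorm.toCompl_star]

theorem maxSingle_apply [DecidableEq ι] (i : ι) (a : A i) :
    maxSingle i a = maxTprod (Function.update 1 i a) := rfl

end UniversalProperty

/-! ## Strongly self-absorbing C*-algebras are simple -/

section Simple

open PiTensorProduct Filter Topology

variable {D : Type u} [CStarAlgebra D]

/-- The permutation of tensor factors `⨂ xᵢ ↦ ⨂ x_{σ⁻¹(i)}`. -/
def maxPerm {n : ℕ} (σ : Equiv.Perm (Fin n)) : MaxTensorPower D n →⋆ₐ[ℂ] MaxTensorPower D n :=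
  maxLift ((maxTprodMultilinear fun _ : Fin n => D).domDomCongr σ⁻¹) maxTprod_one
    (fun x y => maxTprod_mul (fun i => x (σ⁻¹ i)) fun i => y (σ⁻¹ i))
    (fun x => maxTprod_star fun i => x (σ⁻¹ i))

theorem maxPerm_maxTprod {n : ℕ} (σ : Equiv.Perm (Fin n)) (x : Fin n → D) :
    maxPerm σ (maxTprod x) = maxTprod fun i => x (σ⁻¹ i) :=
  maxLift_maxTprod _ _ _ _ x

/-- A two-sided ideal as a complex subspace. -/
def TwoSidedIdeal.toComplexSubmodule (I : TwoSidedIdeal D) : Submodule ℂ D where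
  carrier := I
  add_mem' := I.add_mem
  zero_mem' := I.zero_mem
  smul_mem' c x hx := by
    have := I.mul_mem_left (c • 1) x hx
    rwa [smul_one_mul] at this

theorem TwoSidedIdeal.eq_top_of_isUnit_mem {I : TwoSidedIdeal D} {x : D} (hx : x ∈ I)
    (h : IsUnit x) : I = ⊤ := by
  obtain ⟨u, rfl⟩ := h
  refine TwoSidedIdeal.ext fun y => ⟨fun _ => trivial, fun _ => ?_⟩
  have := I.mul_mem_left (y * ↑u⁻¹) _ hx
  rwa [mul_assoc, Units.inv_mul, mul_one] at this

theorem prodFunctional_mul_mul_eq_zero {I : TwoSidedIdeal D} {f g : D →ₗ[ℂ] ℂ}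
    (hf : ∀ x ∈ I, f x = 0) {d : D} (hd : d ∈ I) (x y : ⨂[ℂ] _ : Fin 2, D) :
    prodFunctional ![f, g] (x * tprod ℂ ![d, 1] * y) = 0 := by
  induction x using PiTensorProduct.induction_on with
  | add x x' hx hx' => rw [add_mul, add_mul, map_add, hx, hx', add_zero]
  | smul_tprod r a =>
    induction y using PiTensorProduct.induction_on with
    | add y y' hy hy' => rw [mul_add, map_add, hy, hy', add_zero]
    | smul_tprod s b =>
      rw [smul_mul_assoc, tprod_mul_tprod, smul_tprod_mul_smul_tprod, map_smul,
        prodFunctional_tprod, Fin.prod_univ_two]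
      have : f (a 0 * d * b 0) = 0 := hf _ (I.mul_mem_right _ _ (I.mul_mem_left _ _ hd))
      simp [this]

/-- If `d` lies in a proper ideal and `1 ⊗ c` is a limit of elements `zₙ (d ⊗ 1) zₙ'`, then
`c = 0`. -/
theorem eq_zero_of_tendsto {I : TwoSidedIdeal D} (hI : I ≠ ⊤) {d : D} (hd : d ∈ I) {c : D}
    {z z' : ℕ → MaxTensorPower D 2}
    (h : Tendsto (fun n => z n * maxTprod ![d, 1] * z' n) atTop (𝓝 (maxTprod ![1, c]))) :
    c = 0 := by
  by_contra hc
  -- A proper ideal contains no units, so some state vanishes on it.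
  obtain ⟨f, hf, hfI⟩ := exists_isState_of_not_isUnit I.toComplexSubmodule
    fun x hx hu => hI (TwoSidedIdeal.eq_top_of_isUnit_mem hx hu)
  obtain ⟨g, hg, hgc⟩ := exists_isState_star_mul_self_ne_zero hc
  have hfg : ∀ i, IsState (![f, g] i) := by
    intro i; fin_cases i
    · exact hf
    · exact hg
  set p := maxCStarSeminorm fun _ : Fin 2 => D
  set F := prodFunctional ![f, g] with hF
  have hext := p.extend_toCompl F (norm_prodFunctional_le hfg)
  have hcont := p.continuous_extend F
  -- On elementary tensors the first factor is `f (a d b)` with `a d b ∈ I`; density does the rest.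
  have hzero : ∀ x y : MaxTensorPower D 2, p.extend F (x * maxTprod ![d, 1] * y) = 0 := by
    intro x y
    induction x, y using p.denseRange_toCompl.induction_on₂ with
    | hp => exact isClosed_eq (hcont.comp (by fun_prop)) continuous_const
    | h x y =>
      rw [maxTprod, ← CStarSeminorm.toCompl_mul, ← CStarSeminorm.toCompl_mul, hext]
      exact prodFunctional_mul_mul_eq_zero hfI hd x y
  -- The factor `1 ⊗ c*` turns the value at the limit into `f(1) g(c* c) ≠ 0`, while every term is
  -- `0`.
  have h1 : Tendsto (fun n => p.extend F (maxTprod ![1, star c] * (z n * maxTprod ![d, 1] * z' n)))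
      atTop (𝓝 (p.extend F (maxTprod ![1, star c] * maxTprod ![1, c]))) :=
    (hcont.tendsto _).comp (h.const_mul _)
  simp only [← mul_assoc, hzero] at h1
  have h2 := tendsto_nhds_unique tendsto_const_nhds h1
  rw [← maxTprod_mul, maxTprod, hext, hF, prodFunctional_tprod] at h2
  simp [hf.map_one, Ne.symm hgc] at h2

theorem maxPerm_swap_maxTprod (a b : D) :
    maxPerm (Equiv.swap (0 : Fin 2) 1) (maxTprod ![a, b]) = maxTprod ![b, a] := by
  rw [maxPerm_maxTprod]
  congr 1
  ext i
  fin_cases i <;> simp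

theorem maxPerm_swap_swap (x : MaxTensorPower D 2) :
    maxPerm (Equiv.swap (0 : Fin 2) 1) (maxPerm (Equiv.swap (0 : Fin 2) 1) x) = x := by
  refine eq_of_eq_on_maxTprod (f := (maxPerm (D := D) (Equiv.swap (0 : Fin 2) 1)).comp
    (maxPerm (Equiv.swap (0 : Fin 2) 1))) (g := StarAlgHom.id ℂ _)
    (StarAlgHom.continuous_of_cstar _) continuous_id (fun a => ?_) x
  simp [maxPerm_maxTprod]

/-- Strongly self-absorbing C*-algebras are simple. -/
theorem IsStronglySelfAbsorbing.eq_zero_of_mem (hD : IsStronglySelfAbsorbing D)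
    {I : TwoSidedIdeal D} (hI : I ≠ ⊤) {d : D} (hd : d ∈ I) : d = 0 := by
  obtain ⟨φ, u, hu⟩ := hD.exists_iso
  let σ : MaxTensorPower D 2 →⋆ₐ[ℂ] MaxTensorPower D 2 := maxPerm (Equiv.swap 0 1)
  have hσ : Continuous σ := σ.continuous_of_cstar
  set c := φ.symm (σ (φ d)) with hc
  have hφc : φ c = σ (φ d) := φ.apply_symm_apply _
  -- The flip of `uₙ φ(c) uₙ* → c ⊗ 1`, using `σ (φ c) = φ d`.
  have h1 : Tendsto (fun n => σ (u n) * φ d * star (σ (u n))) atTop (𝓝 (maxTprod ![1, c])) := by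
    have := (hσ.tendsto _).comp (hu c)
    rw [show σ (maxTprod ![c, 1]) = maxTprod ![1, c] from maxPerm_swap_maxTprod c 1] at this
    refine this.congr fun n => ?_
    rw [Function.comp_apply, map_mul, map_mul, map_star, hφc,
      show σ (σ (φ d)) = φ d from maxPerm_swap_swap _]
  have hun : ∀ n, star (u n : MaxTensorPower D 2) * u n = 1 := fun n =>
    Unitary.star_mul_self_of_mem (u n).2
  -- An inequality, since the algebra is not known to be nontrivial.
  have hnorm : ∀ v : unitary (MaxTensorPower D 2), ‖(v : MaxTensorPower D 2)‖ ≤ 1 := fun v => by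
    have h := CStarRing.norm_star_mul_self (x := (v : MaxTensorPower D 2))
    rw [Unitary.star_mul_self_of_mem v.2] at h
    have h' : ‖(1 : MaxTensorPower D 2)‖ ≤ 1 := by
      have h2 := CStarRing.norm_star_mul_self (x := (1 : MaxTensorPower D 2))
      rw [star_one, mul_one] at h2
      nlinarith [norm_nonneg (1 : MaxTensorPower D 2)]
    nlinarith [norm_nonneg (v : MaxTensorPower D 2)]
  have hσu : ∀ n, ‖σ (u n)‖ ≤ 1 := fun n =>
    (NonUnitalStarAlgHom.norm_apply_le σ _).trans (hnorm _)
  -- Conjugation by `zₙ` carries `uₙ φ(d) uₙ*` to `σ(uₙ) φ(d) σ(uₙ)*`. As `‖zₙ‖ ≤ 1`, the former may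
  -- be replaced by its limit `d ⊗ 1`.
  set z := fun n => σ (u n) * star (u n : MaxTensorPower D 2) with hz
  have hzn : ∀ n, ‖z n‖ ≤ 1 := fun n => (norm_mul_le _ _).trans
    (mul_le_one₀ (hσu n) (norm_nonneg _) (by rw [norm_star]; exact hnorm _))
  have h2 : Tendsto (fun n => z n * (maxTprod ![d, 1] - u n * φ d * star (u n : MaxTensorPower D 2)) *
      star (z n)) atTop (𝓝 0) := by
    have h3 : Tendsto (fun n => ‖maxTprod ![d, 1] - u n * φ d * star (u n : MaxTensorPower D 2)‖)
        atTop (𝓝 0) := by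
      have := ((hu d).const_sub (maxTprod ![d, 1])).norm
      simpa using this
    refine squeeze_zero_norm (fun n => ?_) h3
    refine (norm_mul_le _ _).trans ?_
    rw [norm_star]
    refine (mul_le_of_le_one_right (norm_nonneg _) (hzn n)).trans ((norm_mul_le _ _).trans ?_)
    exact mul_le_of_le_one_left (norm_nonneg _) (hzn n)
  have h3 : Tendsto (fun n => z n * maxTprod ![d, 1] * star (z n)) atTop (𝓝 (maxTprod ![1, c])) := by
    have := h2.add h1
    rw [zero_add] at this
    refine this.congr fun n => ?_
    have e : z n * (u n * φ d * star (u n : MaxTensorPower D 2)) * star (z n) =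
        σ (u n) * φ d * star (σ (u n)) := by
      rw [hz, star_mul, star_star]
      simp only [mul_assoc]
      rw [← mul_assoc (star (u n : MaxTensorPower D 2)) (u n : MaxTensorPower D 2), hun, one_mul,
        ← mul_assoc (star (u n : MaxTensorPower D 2)) (u n : MaxTensorPower D 2), hun, one_mul]
    rw [mul_sub, sub_mul, e, sub_add_cancel]
  have hc0 : c = 0 := eq_zero_of_tendsto hI hd h3
  have : φ d = 0 := by
    rw [← maxPerm_swap_swap (φ d)]
    change σ (σ (φ d)) = 0
    rw [← hφc, hc0, map_zero, map_zero]
  simpa using this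

end Simple

/-! ## Unital *-homomorphisms from tensor powers are full -/

section Full

variable {D : Type u} [CStarAlgebra D]

theorem IsStronglySelfAbsorbing.injective (hD : IsStronglySelfAbsorbing D) {B : Type v}
    [CStarAlgebra B] [Nontrivial B] (f : D →⋆ₐ[ℂ] B) : Function.Injective f := by
  rw [injective_iff_map_eq_zero]
  intro d hd
  refine hD.eq_zero_of_mem (I := TwoSidedIdeal.ker f) (fun h => ?_) ((TwoSidedIdeal.mem_ker f).2 hd)
  have : (1 : D) ∈ TwoSidedIdeal.ker f := h ▸ trivial
  rw [TwoSidedIdeal.mem_ker, map_one] at this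
  exact one_ne_zero this

/-- A unital *-homomorphism from a strongly self-absorbing C*-algebra to a tensor product is
surjective if its image contains all elementary tensors. -/
theorem IsStronglySelfAbsorbing.surjective_of_maxTprod_mem (hD : IsStronglySelfAbsorbing D)
    {ι : Type v} [Finite ι] {A : ι → Type w} [∀ i, CStarAlgebra (A i)]
    (f : D →⋆ₐ[ℂ] MaxTensorProduct A) (h : ∀ a : ∀ i, A i, maxTprod a ∈ Set.range f) :
    Function.Surjective f := by
  rcases subsingleton_or_nontrivial (MaxTensorProduct A) with hs | hn
  · exact fun x => ⟨0, Subsingleton.elim _ _⟩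
  -- By simplicity `f` is injective, hence isometric, so its range is closed.
  · have hf := NonUnitalStarAlgHom.isometry f (hD.injective f)
    let S : Submodule ℂ (MaxTensorProduct A) := LinearMap.range f.toAlgHom.toLinearMap
    exact mem_of_maxTprod_mem (S := S) hf.isClosedEmbedding.isClosed_range h

/-- The *-homomorphism `⨂ xᵢ ↦ 1 ⊗ ⨂ xᵢ`. -/
def maxConsOne (n : ℕ) : MaxTensorPower D n →⋆ₐ[ℂ] MaxTensorPower D (n + 1) :=
  maxLift ((maxTprodMultilinear fun _ : Fin (n + 1) => D).curryLeft 1)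
    (congrArg maxTprod (Fin.cons_self_tail 1))
    (fun x y => by
      rw [MultilinearMap.curryLeft_apply, MultilinearMap.curryLeft_apply,
        MultilinearMap.curryLeft_apply, maxTprodMultilinear_apply, maxTprodMultilinear_apply,
        maxTprodMultilinear_apply, ← maxTprod_mul]
      congr 1
      ext i
      refine Fin.cases ?_ (fun i => ?_) i <;> simp)
    (fun x => by
      rw [MultilinearMap.curryLeft_apply, MultilinearMap.curryLeft_apply,
        maxTprodMultilinear_apply, maxTprodMultilinear_apply, ← maxTprod_star]
      congr 1
      ext i
      refine Fin.cases ?_ (fun i => ?_) i <;> simp)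

theorem maxConsOne_maxTprod {n : ℕ} (x : Fin n → D) :
    maxConsOne n (maxTprod x) = maxTprod (Fin.cons 1 x : Fin (n + 1) → D) :=
  maxLift_maxTprod _ _ _ _ x

/-- The embedding of the first tensor factor. -/
def maxFirst (n : ℕ) : D →⋆ₐ[ℂ] MaxTensorPower D (n + 1) :=
  maxSingle (A := fun _ : Fin (n + 1) => D) 0

theorem maxFirst_apply (n : ℕ) (a : D) :
    maxFirst n a = maxTprod (Fin.cons a 1 : Fin (n + 1) → D) := by
  refine (maxSingle_apply _ _).trans (congrArg maxTprod ?_)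
  ext i
  refine Fin.cases ?_ (fun i => ?_) i <;> simp

theorem maxFirst_mul_maxConsOne {n : ℕ} (a : D) (x : Fin n → D) :
    maxFirst n a * maxConsOne n (maxTprod x) = maxTprod (Fin.cons a x : Fin (n + 1) → D) := by
  rw [maxConsOne_maxTprod, maxFirst_apply, ← maxTprod_mul]
  congr 1
  ext i
  refine Fin.cases ?_ (fun i => ?_) i <;> simp

/-- Centralizers are closed subspaces, so elementary tensors `y` suffice. -/
theorem commute_maxFirst_maxConsOne {n : ℕ} (a : D) (y : MaxTensorPower D n) :
    Commute (maxFirst n a) (maxConsOne n y) := by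
  have hc : Continuous (maxConsOne (D := D) n) :=
    StarAlgHom.continuous_of_cstar (maxConsOne (D := D) n)
  have hS := (Set.isClosed_centralizer {maxFirst n a}).preimage hc
  have h : ∀ x : Fin n → D, maxConsOne n (maxTprod x) ∈ Set.centralizer {maxFirst n a} := by
    rintro x _ rfl
    rw [maxFirst_mul_maxConsOne, maxConsOne_maxTprod, maxFirst_apply, ← maxTprod_mul]
    congr 1
    ext i
    refine Fin.cases ?_ (fun i => ?_) i <;> simp
  have h' := mem_of_maxTprod_mem
    (S := Submodule.comap (maxConsOne (D := D) n).toAlgHom.toLinearMap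
      (Subalgebra.toSubmodule (Subalgebra.centralizer ℂ {maxFirst n a}))) hS h y
  exact h' _ rfl

/-- The *-homomorphism `a ⊗ b ↦ f(a) g(b)` for two commuting *-homomorphisms `f` and `g`. -/
def maxPair {B : Type v} [CStarAlgebra B] (f g : D →⋆ₐ[ℂ] B) (h : ∀ a b, Commute (f a) (g b)) :
    MaxTensorPower D 2 →⋆ₐ[ℂ] B :=
  maxLift ((MultilinearMap.mkPiAlgebraFin ℂ 2 B).compLinearMap
      ![f.toAlgHom.toLinearMap, g.toAlgHom.toLinearMap])
    (by simp)
    (fun x y => by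
      simp only [MultilinearMap.compLinearMap_apply, MultilinearMap.mkPiAlgebraFin_apply,
        List.ofFn_succ, List.ofFn_zero, List.prod_cons, List.prod_nil, mul_one]
      change f (x 0 * y 0) * g (x 1 * y 1) = f (x 0) * g (x 1) * (f (y 0) * g (y 1))
      rw [map_mul, map_mul, (h (y 0) (x 1)).symm.mul_mul_mul_comm])
    (fun x => by
      simp only [MultilinearMap.compLinearMap_apply, MultilinearMap.mkPiAlgebraFin_apply,
        List.ofFn_succ, List.ofFn_zero, List.prod_cons, List.prod_nil, mul_one]
      change f (star (x 0)) * g (star (x 1)) = star (f (x 0) * g (x 1))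
      rw [star_mul, map_star, map_star, ← map_star f, ← map_star g, (h _ _).eq])

theorem maxPair_maxTprod {B : Type v} [CStarAlgebra B] (f g : D →⋆ₐ[ℂ] B)
    (h : ∀ a b, Commute (f a) (g b)) (x : Fin 2 → D) :
    maxPair f g h (maxTprod x) = f (x 0) * g (x 1) := by
  refine (maxLift_maxTprod _ _ _ _ x).trans ?_
  simp only [MultilinearMap.compLinearMap_apply, MultilinearMap.mkPiAlgebraFin_apply,
    List.ofFn_succ, List.ofFn_zero, List.prod_cons, List.prod_nil, mul_one]
  rfl

/-- Compose `D ≅ D ⊗ D` with `id ⊗ f`, where `f` maps `D` onto the previous power. Surjectivity is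
all that fullness needs, and `id ⊗ f` comes from two commuting maps, so no associativity isomorphism
enters. -/
theorem IsStronglySelfAbsorbing.exists_surjective (hD : IsStronglySelfAbsorbing D) (n : ℕ) :
    ∃ f : D →⋆ₐ[ℂ] MaxTensorPower D (n + 1), Function.Surjective f := by
  induction n with
  | zero =>
    refine ⟨maxSingle (A := fun _ : Fin 1 => D) 0, hD.surjective_of_maxTprod_mem _ fun a =>
      ⟨a 0, ?_⟩⟩
    rw [maxSingle_apply]
    congr 1
    ext i
    fin_cases i
    simp
  | succ n ih =>
    obtain ⟨f, hf⟩ := ih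
    obtain ⟨φ, -⟩ := hD.exists_iso
    obtain ⟨g, hg⟩ : ∃ g : MaxTensorPower D 2 →⋆ₐ[ℂ] MaxTensorPower D (n + 1 + 1),
        ∀ x : Fin 2 → D, g (maxTprod x) =
          maxFirst (n + 1) (x 0) * maxConsOne (n + 1) (f (x 1)) :=
      ⟨maxPair (maxFirst (n + 1)) ((maxConsOne (n + 1)).comp f)
        fun a b => commute_maxFirst_maxConsOne a (f b), maxPair_maxTprod _ _ _⟩
    refine ⟨g.comp φ, hD.surjective_of_maxTprod_mem _ fun a => ?_⟩
    obtain ⟨b, hb⟩ := hf (maxTprod fun i => a i.succ)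
    refine ⟨φ.symm (maxTprod ![a 0, b]), ?_⟩
    change g (φ (φ.symm (maxTprod ![a 0, b]))) = _
    rw [StarAlgEquiv.apply_symm_apply, hg]
    change maxFirst (n + 1) (a 0) * maxConsOne (n + 1) (f b) = _
    rw [hb, maxFirst_mul_maxConsOne]
    exact congrArg maxTprod (Fin.cons_self_tail a)

/-- The only elementary tensor is `1`, and its span is finite-dimensional, hence closed. -/
theorem exists_smul_one_eq (x : MaxTensorPower D 0) : ∃ c : ℂ, c • (1 : MaxTensorPower D 0) = x := by
  rw [← Submodule.mem_span_singleton]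
  refine mem_of_maxTprod_mem (S := Submodule.span ℂ {(1 : MaxTensorPower D 0)})
    (Submodule.closed_of_finiteDimensional _) (fun a => ?_) x
  rw [Subsingleton.elim a 1, maxTprod_one]
  exact Submodule.mem_span_singleton_self _

/-- Unital *-homomorphisms from a tensor power of `D` to `D` are full. -/
theorem IsStronglySelfAbsorbing.isFullHom (hD : IsStronglySelfAbsorbing D) {n : ℕ}
    (f : MaxTensorPower D n →⋆ₐ[ℂ] D) : IsFullHom f := by
  intro a ha I _ hI
  by_contra hI'
  have h0 : f a = 0 := hD.eq_zero_of_mem hI' hI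
  have : Nontrivial D := by
    by_contra h
    rw [not_nontrivial_iff_subsingleton] at h
    exact hI' (TwoSidedIdeal.ext fun x =>
      ⟨fun _ => trivial, fun _ => Subsingleton.elim 0 x ▸ I.zero_mem⟩)
  cases n with
  | zero =>
    obtain ⟨c, rfl⟩ := exists_smul_one_eq a
    rw [map_smul, map_one, smul_eq_zero_iff_left one_ne_zero] at h0
    exact ha (by rw [h0, zero_smul])
  | succ n =>
    obtain ⟨g, hg⟩ := hD.exists_surjective n
    obtain ⟨b, rfl⟩ := hg a
    -- Simplicity of the tensor power is bypassed: `f ∘ g` starts at `D` itself.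
    have : b = 0 := hD.injective (f.comp g) (by rw [map_zero]; exact h0)
    exact ha (by rw [this, map_zero])

end Full

/-! ## The point-norm topology -/

section Topology

open Topology Filter

theorem continuous_maxTprod {ι : Type v} [Finite ι] {A : ι → Type w} [∀ i, CStarAlgebra (A i)] :
    Continuous (maxTprod : (∀ i, A i) → MaxTensorProduct A) := by
  have := Fintype.ofFinite ι
  refine (maxTprodMultilinear A).continuous_of_bound 1 fun a => ?_
  rw [one_mul, maxTprodMultilinear_apply, maxTprod, CStarSeminorm.norm_toCompl]
  exact CStarSeminorm.map_tprod_le _ a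

namespace UnitalFullHom

variable {D : Type u} [CStarAlgebra D] {n : ℕ}

@[ext]
theorem ext_maxTprod {f g : UnitalFullHom D n}
    (h : ∀ x : Fin n → D, f (maxTprod x) = g (maxTprod x)) :
    f = g :=
  Subtype.ext (starAlgHom_ext_maxTprod h)

theorem continuous_eval (x : MaxTensorPower D n) : Continuous fun f : UnitalFullHom D n => f x :=
  (continuous_apply x).comp continuous_induced_dom

theorem norm_apply_le (f : UnitalFullHom D n) (x : MaxTensorPower D n) : ‖f x‖ ≤ ‖x‖ :=
  NonUnitalStarAlgHom.norm_apply_le f.1 x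

theorem norm_apply_sub_apply_le (f : UnitalFullHom D n) (x y : MaxTensorPower D n) :
    ‖f x - f y‖ ≤ ‖x - y‖ := by
  have h : f x - f y = f (x - y) := (map_sub f.1 x y).symm
  rw [h]
  exact f.norm_apply_le _

/-- Point-norm convergence suffices because all `F y` are contractive: moving the argument costs at
most `‖x y - x y₀‖`. -/
theorem continuous_apply_apply {Y : Type*} [TopologicalSpace Y] {F : Y → UnitalFullHom D n}
    {x : Y → MaxTensorPower D n} (hF : Continuous F) (hx : Continuous x) :
    Continuous fun y => F y (x y) := by
  rw [continuous_iff_continuousAt]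
  intro y₀
  have h1 : Tendsto (fun y => F y (x y₀)) (𝓝 y₀) (𝓝 (F y₀ (x y₀))) :=
    ((continuous_eval (x y₀)).comp hF).tendsto y₀
  have h2 : Tendsto (fun y => F y (x y) - F y (x y₀)) (𝓝 y₀) (𝓝 0) := by
    have h3 : Tendsto (fun y => ‖x y - x y₀‖) (𝓝 y₀) (𝓝 0) := by
      have := ((hx.tendsto y₀).sub_const (x y₀)).norm
      simpa using this
    exact squeeze_zero_norm (fun y => (F y).norm_apply_sub_apply_le _ _) h3
  have := h2.add h1
  simpa [ContinuousAt] using this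

/-- An `ε/3` argument, with contractivity giving uniformity in `y`. -/
theorem isClosed_setOf_continuous_eval {Y : Type*} [TopologicalSpace Y]
    (F : Y → UnitalFullHom D n) :
    IsClosed {x : MaxTensorPower D n | Continuous fun y => F y x} := by
  refine isClosed_of_closure_subset fun x hx => ?_
  rw [Set.mem_ofPred_eq, continuous_iff_continuousAt]
  intro y₀
  rw [Metric.continuousAt_iff']
  intro ε hε
  obtain ⟨z, hz, hxz⟩ := Metric.mem_closure_iff.1 hx (ε / 3) (by positivity)
  have hz' : Continuous fun y => F y z := hz
  filter_upwards [Metric.continuousAt_iff'.1 (hz'.continuousAt (x := y₀)) (ε / 3) (by positivity)]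
    with y hy
  rw [dist_eq_norm] at hxz hy ⊢
  have h1 := (F y).norm_apply_sub_apply_le x z
  have h2 := (F y₀).norm_apply_sub_apply_le z x
  rw [norm_sub_rev z x] at h2
  have h3 : F y x - F y₀ x = (F y x - F y z) + (F y z - F y₀ z) + (F y₀ z - F y₀ x) := by abel
  rw [h3]
  refine (norm_add₃_le).trans_lt ?_
  linarith

theorem continuous_of_forall_eval {Y : Type*} [TopologicalSpace Y] {F : Y → UnitalFullHom D n}
    (h : ∀ x, Continuous fun y => F y x) : Continuous F :=
  continuous_induced_rng.2 (continuous_pi h)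

/-- A map to the space of unital full *-homomorphisms is continuous if its evaluations at
elementary tensors are. -/
theorem continuous_of_forall_eval_maxTprod {Y : Type*} [TopologicalSpace Y]
    {F : Y → UnitalFullHom D n} (h : ∀ a : Fin n → D, Continuous fun y => F y (maxTprod a)) :
    Continuous F := by
  refine continuous_of_forall_eval fun x => ?_
  let S : Submodule ℂ (MaxTensorPower D n) :=
    { carrier := {x | Continuous fun y => F y x}
      add_mem' := fun {a b} ha hb => by
        have : (fun y => F y (a + b)) = fun y => F y a + F y b :=
          funext fun y => map_add (F y).1 a b
        rw [Set.mem_ofPred_eq, this]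
        exact Continuous.add ha hb
      zero_mem' := by
        have : (fun y => F y 0) = fun _ => 0 := funext fun y => map_zero (F y).1
        rw [Set.mem_ofPred_eq, this]
        exact continuous_const
      smul_mem' := fun c a ha => by
        have : (fun y => F y (c • a)) = fun y => c • F y a :=
          funext fun y => map_smul (F y).1 c a
        rw [Set.mem_ofPred_eq, this]
        exact Continuous.const_smul ha c }
  exact mem_of_maxTprod_mem (S := S) (isClosed_setOf_continuous_eval F) h x

instance : T2Space (UnitalFullHom D n) :=
  .of_injective_continuous (f := fun f : UnitalFullHom D n => (f : MaxTensorPower D n → D))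
    (fun _ _ h => Subtype.ext (DFunLike.coe_injective h)) continuous_induced_dom

theorem continuous_of_denseRange {Y κ : Type*} [TopologicalSpace Y] {F : Y → UnitalFullHom D n}
    {d : κ → Fin n → D} (hd : DenseRange d) (h : ∀ k, Continuous fun y => F y (maxTprod (d k))) :
    Continuous F := by
  refine continuous_of_forall_eval_maxTprod fun a => ?_
  have hcl : IsClosed {a : Fin n → D | Continuous fun y => F y (maxTprod a)} :=
    (isClosed_setOf_continuous_eval F).preimage continuous_maxTprod
  exact hd.induction_on (p := fun a => Continuous fun y => F y (maxTprod a)) a hcl h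

/-- Evaluation at a dense sequence of families in `Fin n → D` induces the point-norm topology from
the first countable space `ℕ → D`. -/
theorem firstCountableTopology [TopologicalSpace.SeparableSpace D] :
    FirstCountableTopology (UnitalFullHom D n) := by
  let d := TopologicalSpace.denseSeq (Fin n → D)
  let r : UnitalFullHom D n → ℕ → D := fun f k => f (maxTprod (d k))
  have hr : IsInducing r := by
    refine ⟨le_antisymm (continuous_iff_le_induced.1 (continuous_pi fun k => continuous_eval _)) ?_⟩
    refine continuous_id_iff_le.1 ?_
    -- It remains to show that the identity is continuous from the topology induced by `r` to the
    -- point-norm topology.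
    let t : TopologicalSpace (UnitalFullHom D n) := .induced r inferInstance
    have ht : @Continuous _ _ t _ r := continuous_induced_dom
    exact @continuous_of_denseRange D _ n _ ℕ t id _ (TopologicalSpace.denseRange_denseSeq _)
      fun k => @Continuous.comp _ _ _ t _ _ _ _ (continuous_apply k) ht
  exact hr.firstCountableTopology

theorem isWeaklyHausdorff : IsWeaklyHausdorff (UnitalFullHom D n) :=
  fun _ _ _ _ _ hf => (isCompact_range hf).isClosed

theorem compactlyGeneratedSpace [TopologicalSpace.SeparableSpace D] :
    CompactlyGeneratedSpace (UnitalFullHom D n) := by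
  have : FirstCountableTopology (UnitalFullHom D n) := firstCountableTopology
  infer_instance

end UnitalFullHom

/-- The compactly generated topology is finer than the given one. -/
theorem Continuous.of_compactlyGenerated {X : Type u} {Y : Type v} [TopologicalSpace X]
    [TopologicalSpace Y] {f : X → Y} (hf : Continuous f) :
    @Continuous _ _ (TopologicalSpace.compactlyGenerated.{w} X) _ f :=
  continuous_from_compactlyGenerated f fun _ g => hf.comp g.continuous

end Topology

/-! ## Block decompositions -/

section Blocks

variable {k n : ℕ}

/-- Position as a number: the lengths of the earlier blocks plus the offset. This turns the
identities for nested blocks into arithmetic. -/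
theorem blockEquiv_val (j : Fin k → ℕ) (h : ∑ s, j s = n) (s : Fin k) (r : Fin (j s)) :
    (blockEquiv j h ⟨s, r⟩ : ℕ) = ∑ s' ∈ Finset.Iio s, j s' + r := by
  rw [blockEquiv, Equiv.trans_apply, finCongr_apply, Fin.val_cast, finSigmaFinEquiv_apply]
  congr 1
  refine Finset.sum_bij (fun i _ => Fin.castLE s.2.le i) (fun i _ => ?_) (fun a _ b _ hab => ?_)
    (fun b hb => ?_) (fun _ _ => rfl)
  · rw [Finset.mem_Iio, Fin.lt_def]; exact i.2
  · exact Fin.castLE_injective _ hab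
  · rw [Finset.mem_Iio, Fin.lt_def] at hb
    exact ⟨⟨b, hb⟩, Finset.mem_univ _, rfl⟩

theorem blockEquiv_lt_of_lt (j : Fin k → ℕ) (h : ∑ s, j s = n) {s s' : Fin k} (hs : s < s')
    (r : Fin (j s)) (r' : Fin (j s')) : blockEquiv j h ⟨s, r⟩ < blockEquiv j h ⟨s', r'⟩ := by
  rw [Fin.lt_def, blockEquiv_val, blockEquiv_val]
  have h1 : ∑ t ∈ insert s (Finset.Iio s), j t ≤ ∑ t ∈ Finset.Iio s', j t := by
    refine Finset.sum_le_sum_of_subset fun t ht => ?_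
    rw [Finset.mem_insert, Finset.mem_Iio] at ht
    rw [Finset.mem_Iio]
    rcases ht with rfl | ht
    · exact hs
    · exact ht.trans hs
  rw [Finset.sum_insert (by simp)] at h1
  have := r.2
  omega

theorem blockEquiv_lt_iff (j : Fin k → ℕ) (h : ∑ s, j s = n) (s : Fin k) (r r' : Fin (j s)) :
    blockEquiv j h ⟨s, r⟩ < blockEquiv j h ⟨s, r'⟩ ↔ r < r' := by
  rw [Fin.lt_def, blockEquiv_val, blockEquiv_val, Fin.lt_def]
  omega

/-- A sum over an initial segment, split into blocks. -/
theorem sum_Iio_blockEquiv (j : Fin k → ℕ) (h : ∑ s, j s = n) (g : (Σ s : Fin k, Fin (j s)) → ℕ)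
    (s : Fin k) (r : Fin (j s)) :
    ∑ t ∈ Finset.Iio (blockEquiv j h ⟨s, r⟩), g ((blockEquiv j h).symm t) =
      ∑ s' ∈ Finset.Iio s, ∑ r', g ⟨s', r'⟩ + ∑ r' ∈ Finset.Iio r, g ⟨s, r'⟩ := by
  have h1 : ∑ t ∈ Finset.Iio (blockEquiv j h ⟨s, r⟩), g ((blockEquiv j h).symm t) =
      ∑ s', ∑ r', if blockEquiv j h ⟨s', r'⟩ < blockEquiv j h ⟨s, r⟩ then g ⟨s', r'⟩ else 0 := by
    rw [← Fintype.sum_sigma' fun s' r' =>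
      if blockEquiv j h ⟨s', r'⟩ < blockEquiv j h ⟨s, r⟩ then g ⟨s', r'⟩ else 0,
      ← (blockEquiv j h).symm.sum_comp]
    simp only [Sigma.eta, Equiv.apply_symm_apply]
    rw [← Finset.sum_filter]
    congr 1
    ext t
    simp
  -- Blocks before `s` count in full, block `s` up to `r`, and later blocks not at all.
  rw [h1, ← Finset.sum_filter_add_sum_filter_not Finset.univ (· < s)]
  congr 1
  · refine Finset.sum_congr (by ext; simp) fun s' hs' => Finset.sum_congr rfl fun r' _ => ?_
    rw [if_pos (blockEquiv_lt_of_lt j h (by simpa using hs') r' r)]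
  · rw [Finset.sum_eq_single s]
    · rw [← Finset.sum_filter]
      refine Finset.sum_congr ?_ fun _ _ => rfl
      ext r'
      simp [blockEquiv_lt_iff]
    · intro s' hs' hne
      refine Finset.sum_eq_zero fun r' _ => if_neg (not_lt.2 (le_of_lt ?_))
      refine blockEquiv_lt_of_lt j h (lt_of_le_of_ne ?_ hne.symm) r r'
      simpa using hs'
    · simp

/-- The two ways to decompose a block decomposition into smaller blocks agree. -/
theorem blockEquiv_assoc {m : ℕ} (j : Fin k → ℕ) (h : ∑ s, j s = m)
    (i : ∀ s, Fin (j s) → ℕ) (l : Fin k → ℕ) (hl : ∀ s, ∑ r, i s r = l s) (hn : ∑ s, l s = n)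
    (hn' : ∑ t : Fin m, i ((blockEquiv j h).symm t).1 ((blockEquiv j h).symm t).2 = n)
    (s : Fin k) (r : Fin (j s)) (q : Fin (i s r))
    (q' : Fin (i ((blockEquiv j h).symm (blockEquiv j h ⟨s, r⟩)).1
      ((blockEquiv j h).symm (blockEquiv j h ⟨s, r⟩)).2)) (hq : (q' : ℕ) = q) :
    blockEquiv (fun t => i ((blockEquiv j h).symm t).1 ((blockEquiv j h).symm t).2) hn'
        ⟨blockEquiv j h ⟨s, r⟩, q'⟩ =
      blockEquiv l hn ⟨s, blockEquiv (i s) (hl s) ⟨r, q⟩⟩ := by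
  -- `q` and `q'` live in types that agree only up to rewriting, so they are compared as numbers.
  rw [Fin.ext_iff, blockEquiv_val, blockEquiv_val, blockEquiv_val,
    sum_Iio_blockEquiv j h (fun p => i p.1 p.2), hq, add_assoc]
  simp only [hl]

theorem blockPerm_blockEquiv (j : Fin k → ℕ) (h : ∑ s, j s = n) (σ : Equiv.Perm (Fin k))
    (h' : ∑ s, j (σ s) = n) (s : Fin k) (r : Fin (j (σ s))) :
    blockPerm j h σ h' (blockEquiv (fun s => j (σ s)) h' ⟨s, r⟩) = blockEquiv j h ⟨σ s, r⟩ := by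
  simp [blockPerm, Equiv.sigmaCongrLeft_apply]

theorem sumPerm_inv_blockEquiv (j : Fin k → ℕ) (h : ∑ s, j s = n)
    (τ : ∀ s, Equiv.Perm (Fin (j s))) (s : Fin k) (r : Fin (j s)) :
    (sumPerm j h τ)⁻¹ (blockEquiv j h ⟨s, r⟩) = blockEquiv j h ⟨s, (τ s)⁻¹ r⟩ := by
  rw [Equiv.Perm.inv_eq_iff_eq]
  simp [sumPerm]

theorem blockEquiv_const_zero (h : ∑ _s : Fin 1, n = n) (r : Fin n) :
    blockEquiv (fun _ : Fin 1 => n) h ⟨0, r⟩ = r := by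
  rw [Fin.ext_iff, blockEquiv_val]
  simp

theorem blockEquiv_one (h : ∑ _s : Fin k, 1 = k) (s : Fin k) (r : Fin 1) :
    blockEquiv (fun _ : Fin k => 1) h ⟨s, r⟩ = s := by
  rw [Fin.ext_iff, blockEquiv_val]
  simp

end Blocks

/-! ## The operad -/

section Operad

variable {D : Type u} [CStarAlgebra D]

/-- The *-homomorphism `α ∘ (β₁ ⊗ ⋯ ⊗ βₖ)`. -/
def operadComp {k n : ℕ} (j : Fin k → ℕ) (h : ∑ s, j s = n) (α : MaxTensorPower D k →⋆ₐ[ℂ] D)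
    (β : ∀ s, MaxTensorPower D (j s) →⋆ₐ[ℂ] D) : MaxTensorPower D n →⋆ₐ[ℂ] D :=
  maxLift
    ((α.toAlgHom.toLinearMap.compMultilinearMap
      ((maxTprodMultilinear fun _ : Fin k => D).compMultilinearMap fun s =>
        (β s).toAlgHom.toLinearMap.compMultilinearMap
          (maxTprodMultilinear fun _ : Fin (j s) => D))).domDomCongr (blockEquiv j h))
    (by
      change α (maxTprod fun s => β s 1) = 1
      simp only [map_one]
      exact map_one α)
    (fun x y => by
      change α (maxTprod fun s => β s (maxTprod ((fun r => x (blockEquiv j h ⟨s, r⟩)) *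
        fun r => y (blockEquiv j h ⟨s, r⟩)))) =
          α (maxTprod fun s => β s (maxTprod fun r => x (blockEquiv j h ⟨s, r⟩))) *
          α (maxTprod fun s => β s (maxTprod fun r => y (blockEquiv j h ⟨s, r⟩)))
      simp only [maxTprod_mul, map_mul]
      rw [← map_mul, ← maxTprod_mul]
      rfl)
    (fun x => by
      change α (maxTprod fun s => β s (maxTprod (star fun r => x (blockEquiv j h ⟨s, r⟩)))) =
          star (α (maxTprod fun s => β s (maxTprod fun r => x (blockEquiv j h ⟨s, r⟩))))
      simp only [maxTprod_star, map_star]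
      rw [← map_star, ← maxTprod_star]
      rfl)

theorem operadComp_maxTprod {k n : ℕ} (j : Fin k → ℕ) (h : ∑ s, j s = n)
    (α : MaxTensorPower D k →⋆ₐ[ℂ] D) (β : ∀ s, MaxTensorPower D (j s) →⋆ₐ[ℂ] D) (x : Fin n → D) :
    operadComp j h α β (maxTprod x) =
      α (maxTprod fun s => β s (maxTprod fun r => x (blockEquiv j h ⟨s, r⟩))) :=
  maxLift_maxTprod _ _ _ _ x

variable (D) in
/-- The *-homomorphism `x ↦ x` from the first tensor power. -/
def operadOne : MaxTensorPower D 1 →⋆ₐ[ℂ] D :=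
  maxLift (LinearMap.id.compMultilinearMap
      ((MultilinearMap.mkPiAlgebraFin ℂ 1 D)))
    (by simp) (fun x y => by simp) (fun x => by simp)

theorem operadOne_maxTprod (x : Fin 1 → D) : operadOne D (maxTprod x) = x 0 :=
  (maxLift_maxTprod _ _ _ _ x).trans (by simp)

namespace IsStronglySelfAbsorbing

variable (hD : IsStronglySelfAbsorbing D)

/-- The composition of the operad. -/
def comp {k n : ℕ} (j : Fin k → ℕ) (h : ∑ s, j s = n) (α : UnitalFullHom D k)
    (β : ∀ s, UnitalFullHom D (j s)) : UnitalFullHom D n :=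
  ⟨operadComp j h α.1 fun s => (β s).1, hD.isFullHom _⟩

theorem comp_maxTprod {k n : ℕ} (j : Fin k → ℕ) (h : ∑ s, j s = n) (α : UnitalFullHom D k)
    (β : ∀ s, UnitalFullHom D (j s)) (x : Fin n → D) :
    hD.comp j h α β (maxTprod x) =
      α (maxTprod fun s => β s (maxTprod fun r => x (blockEquiv j h ⟨s, r⟩))) :=
  operadComp_maxTprod j h α.1 (fun s => (β s).1) x

/-- The unit of the operad. -/
def one : UnitalFullHom D 1 := ⟨operadOne D, hD.isFullHom _⟩

theorem one_maxTprod (x : Fin 1 → D) : hD.one (maxTprod x) = x 0 := operadOne_maxTprod x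

/-- The action of the symmetric groups on the operad. -/
def act {n : ℕ} (α : UnitalFullHom D n) (σ : Equiv.Perm (Fin n)) : UnitalFullHom D n :=
  ⟨α.1.comp (maxPerm σ), hD.isFullHom _⟩

theorem act_maxTprod {n : ℕ} (α : UnitalFullHom D n) (σ : Equiv.Perm (Fin n)) (x : Fin n → D) :
    hD.act α σ (maxTprod x) = α (maxTprod fun i => x (σ⁻¹ i)) :=
  congrArg α.1 (maxPerm_maxTprod σ x)

theorem continuous_act {n : ℕ} (σ : Equiv.Perm (Fin n)) :
    Continuous fun c : UnitalFullHom D n => hD.act c σ :=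
  UnitalFullHom.continuous_of_forall_eval fun x => UnitalFullHom.continuous_eval (maxPerm σ x)

/-- On an elementary tensor, composition is `α` evaluated at a point depending continuously on the
`βₛ`, so joint continuity of evaluation applies, already for the ordinary product topology. -/
theorem continuous_comp {k n : ℕ} (j : Fin k → ℕ) (h : ∑ s, j s = n) :
    Continuous fun x : UnitalFullHom D k × ∀ s, UnitalFullHom D (j s) => hD.comp j h x.1 x.2 := by
  refine UnitalFullHom.continuous_of_forall_eval_maxTprod fun a => ?_
  simp only [comp_maxTprod]
  refine UnitalFullHom.continuous_apply_apply continuous_fst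
    (continuous_maxTprod.comp (continuous_pi fun s => ?_))
  exact (UnitalFullHom.continuous_eval _).comp ((continuous_apply s).comp continuous_snd)

/-- Associativity meets `e` at an index that equals `⟨s, r⟩` only propositionally. This transports
along that equality, matching arguments by their numerical positions. -/
theorem apply_maxTprod_congr {k : ℕ} {j : Fin k → ℕ} {i : ∀ s, Fin (j s) → ℕ}
    (e : ∀ s r, UnitalFullHom D (i s r)) {p p' : Σ s, Fin (j s)} (hp : p = p')
    {y : Fin (i p.1 p.2) → D} {y' : Fin (i p'.1 p'.2) → D}
    (h : ∀ (q : Fin (i p.1 p.2)) (q' : Fin (i p'.1 p'.2)), (q : ℕ) = q' → y q = y' q') :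
    e p.1 p.2 (maxTprod y) = e p'.1 p'.2 (maxTprod y') := by
  subst hp
  congr 2
  exact funext fun q => h q q rfl

theorem comp_assoc {k m n : ℕ} (j : Fin k → ℕ) (h : ∑ s, j s = m)
    (i : ∀ s, Fin (j s) → ℕ) (l : Fin k → ℕ) (hl : ∀ s, ∑ r, i s r = l s) (hn : ∑ s, l s = n)
    (hn' : ∑ t : Fin m, i ((blockEquiv j h).symm t).1 ((blockEquiv j h).symm t).2 = n)
    (c : UnitalFullHom D k) (d : ∀ s, UnitalFullHom D (j s)) (e : ∀ s r, UnitalFullHom D (i s r)) :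
    hD.comp (fun t => i ((blockEquiv j h).symm t).1 ((blockEquiv j h).symm t).2) hn'
        (hD.comp j h c d) (fun t => e ((blockEquiv j h).symm t).1 ((blockEquiv j h).symm t).2) =
      hD.comp l hn c fun s => hD.comp (i s) (hl s) (d s) (e s) := by
  ext x
  simp only [comp_maxTprod]
  congr 2
  ext s
  congr 2
  ext r
  refine apply_maxTprod_congr e (p' := ⟨s, r⟩) ((blockEquiv j h).symm_apply_apply _)
    fun q q' hq => ?_
  rw [blockEquiv_assoc j h i l hl hn hn' s r q' q hq]

theorem act_comp {k n : ℕ} (j : Fin k → ℕ) (h : ∑ s, j s = n) (σ : Equiv.Perm (Fin k))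
    (h' : ∑ s, j (σ s) = n) (c : UnitalFullHom D k) (d : ∀ s, UnitalFullHom D (j s)) :
    hD.comp (fun s => j (σ s)) h' (hD.act c σ) (fun s => d (σ s)) =
      hD.act (hD.comp j h c d) (blockPerm j h σ h') := by
  ext x
  rw [comp_maxTprod, act_maxTprod, act_maxTprod, comp_maxTprod]
  congr 2
  ext s
  -- Naming the block `σ s` puts both offsets in `Fin (j (σ s))`, so that `blockPerm` can be
  -- evaluated.
  obtain ⟨s, rfl⟩ := σ.surjective s
  have key : ∀ s r, (blockPerm j h σ h')⁻¹ (blockEquiv j h ⟨σ s, r⟩) =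
      blockEquiv (fun s => j (σ s)) h' ⟨s, r⟩ := fun s r => by
    rw [Equiv.Perm.inv_eq_iff_eq, blockPerm_blockEquiv]
  simp only [key]
  have hs : σ⁻¹ (σ s) = s := σ.symm_apply_apply s
  rw [hs]

/-- The operad of unital full *-homomorphisms from the tensor powers of `D` to `D`. -/
def operad : OperadStructure (UnitalFullHom D) where
  compactlyGenerated n :=
    have := hD.separable
    UnitalFullHom.compactlyGeneratedSpace
  weaklyHausdorff n := UnitalFullHom.isWeaklyHausdorff
  act := hD.act
  one := hD.one
  comp := hD.comp
  continuous_act := hD.continuous_act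
  continuous_comp j h := (hD.continuous_comp j h).of_compactlyGenerated
  act_one c := by
    ext x
    simp [act_maxTprod]
  act_mul c σ τ := by
    ext x
    simp [act_maxTprod, mul_inv_rev]
  one_comp h c := by
    ext x
    rw [comp_maxTprod, one_maxTprod]
    simp only [blockEquiv_const_zero]
  comp_one h c := by
    ext x
    simp only [comp_maxTprod, one_maxTprod, blockEquiv_one]
  assoc := hD.comp_assoc
  act_comp := hD.act_comp
  comp_act j h τ c d := by
    ext x
    simp only [comp_maxTprod, act_maxTprod, sumPerm_inv_blockEquiv]

end IsStronglySelfAbsorbing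

end Operad

end

theorem lemma3p1 (D : Type u) [CStarAlgebra D] (hD : IsStronglySelfAbsorbing D) :
    ∃ O : OperadStructure (UnitalFullHom D),
      (∀ {k n : ℕ} (j : Fin k → ℕ) (h : ∑ s, j s = n) (α : UnitalFullHom D k)
        (β : ∀ s, UnitalFullHom D (j s)) (x : ∀ s, Fin (j s) → D),
        O.comp j h α β (maxTprod fun t : Fin n =>
            x ((blockEquiv j h).symm t).1 ((blockEquiv j h).symm t).2) =
          α (maxTprod fun s => β s (maxTprod (x s)))) ∧
      (∀ x : Fin 1 → D, O.one (maxTprod x) = x 0) ∧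
      (∀ {n : ℕ} (α : UnitalFullHom D n) (σ : Equiv.Perm (Fin n)) (x : Fin n → D),
        O.act α σ (maxTprod x) = α (maxTprod fun i => x (σ⁻¹ i))) := by
  refine ⟨hD.operad, fun j h α β x => ?_, hD.one_maxTprod, hD.act_maxTprod⟩
  refine (hD.comp_maxTprod j h α β _).trans ?_
  congr 2
  ext s
  congr 2
  ext r
  exact congrArg (fun p : Σ s, Fin (j s) => x p.1 p.2) ((blockEquiv j h).symm_apply_apply ⟨s, r⟩)
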